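/- Let $V:(0,1)\to\mathbb{C}$ be a measurable function with $\int_0^1 r(1-\log r)\,|V(r)|\,dr<\infty$. For $m\in\mathbb{N}_0$ let $y_m$ be the regular solution of the perturbed Bessel equation $-y''+\frac{m^2-1/4}{r^2}y+V(r)y=0$ on $(0,1)$, with $y_m(r)\sim r^{m+1/2}$ and $y_m'(r)\sim (m+\tfrac12)r^{m-1/2}$ as $r\to0^+$, given explicitly by $$y_m(r)=\sum_{k=0}^{\infty}\psi^{(m)}_k(r),\qquad \psi^{(m)}_0(r)=r^{m+\frac12},\qquad \psi^{(m)}_{k}(r)=\int_0^r \mathcal{L}_m(r,s)V(s)\psi^{(m)}_{k-1}(s)\,ds\quad(k\ge 1),$$ where $$\mathcal{L}_0(r,s)=\sqrt{rs}\,\log\frac rs,\qquad \mathcal{L}_m(r,s)=\frac{1}{2m}\left(\frac{r^{m+1/2}}{s^{m-1/2}}-\frac{s^{m+1/2}}{r^{m-1/2}}\right)\quad (m\ge1).$$ Put $\alpha_m(r)=y_m(r)/r^{m+1/2}$ for $0<r\le1$ and $\alpha_m(0)=1$, and assume that $\alpha_m(1)\neq0$ for every $m\in\mathbb{N}_0$.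 Let $f\in\mathscr{D}'(\mathbb{S}^1)$, that is, let $f$ be a continuous linear functional on $\mathscr{D}(\mathbb{S}^1)=C^\infty(\mathbb{S}^1)$ with its Fréchet topology, the elements of $C^\infty(\mathbb{S}^1)$ being viewed as smooth $2\pi$-periodic functions of the angle $\theta$. Write $\widehat f_m=\frac1{2\pi}(f\,|\,e^{-im\theta})$ for $m\in\mathbb{Z}$. Then the series $$u_f(r,\theta)=\sum_{m\in\mathbb{Z}}\frac{r^{|m|}\alpha_{|m|}(r)}{\alpha_{|m|}(1)}\,\widehat f_m\,e^{im\theta}$$ converges absolutely at every point $(r,\theta)$ of the open unit disk $\mathbb{B}^2$ (polar coordinates, $0\le r<1$), and the following hold. 1. $u_f$ is a distributional solution of $-\Delta u+V(|x|)u=0$ in $\mathbb{B}^2$: $u_f\in L^1_{loc}(\mathbb{B}^2)$, and for every $\varphi\in C_0^\infty(\mathbb{B}^2)$ the function $u_f(-\Delta\varphi+V\varphi)$ is integrable on $\mathbb{B}^2$ and $\int_{\mathbb{B}^2}u_f(-\Delta\varphi+V\varphi)\,dx=0$. 2. $u_f$ has distributional boundary value $f$: $u_f(r,\cdot)$ is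 integrable on $\mathbb{S}^1$ for all $r<1$ close to $1$, and $$\lim_{r\to1^-}\int_0^{2\pi}u_f(r,\theta)\varphi(\theta)\,d\theta=(f\,|\,\varphi)\qquad\text{for all }\varphi\in C^\infty(\mathbb{S}^1).$$ -/

import Mathlib

open Set Filter Topology MeasureTheory
open scoped ContDiff

noncomputable section

/-! ### Test functions and distributions on the unit circle -/

/-- The complex vector space of smooth `2π`-periodic functions `ℝ → ℂ`. -/
def circleTestSubmodule : Submodule ℂ (ℝ → ℂ) where
  carrier := {φ | ContDiff ℝ ∞ φ ∧ Function.Periodic φ (2 * Real.pi)}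
  add_mem' := fun ha hb => ⟨ha.1.add hb.1, ha.2.add hb.2⟩
  zero_mem' := ⟨contDiff_const, fun _ => rfl⟩
  smul_mem' := fun c _ ha => ⟨contDiff_const.smul ha.1, ha.2.smul c⟩

/-- `𝒟(𝕊¹) = C^∞(𝕊¹)`: a function on the circle is identified with a `2π`-periodic function of
the angle.  This is a type of its own so that it does not inherit the topology of pointwise
convergence from `ℝ → ℂ`. -/
def CircleTest : Type := ↥circleTestSubmodule

namespace CircleTest

instance instAddCommGroup : AddCommGroup CircleTest :=
  inferInstanceAs (AddCommGroup ↥circleTestSubmodule)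

instance instModule : Module ℂ CircleTest :=
  inferInstanceAs (Module ℂ ↥circleTestSubmodule)

/-- The value of a test function at the angle `θ`. -/
def toFun (φ : CircleTest) : ℝ → ℂ := φ.1

instance instCoeFun : CoeFun CircleTest (fun _ => ℝ → ℂ) := ⟨toFun⟩

theorem contDiff (φ : CircleTest) : ContDiff ℝ ∞ (φ : ℝ → ℂ) := φ.2.1

theorem periodic (φ : CircleTest) : Function.Periodic (φ : ℝ → ℂ) (2 * Real.pi) := φ.2.2

theorem coe_add (φ ψ : CircleTest) : ((φ + ψ : CircleTest) : ℝ → ℂ) = φ + ψ := rfl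

theorem coe_smul (c : ℂ) (φ : CircleTest) : ((c • φ : CircleTest) : ℝ → ℂ) = c • (φ : ℝ → ℂ) := rfl

theorem bddAbove_iteratedDeriv (φ : CircleTest) (j : ℕ) :
    BddAbove (range fun θ : ℝ => ‖iteratedDeriv j φ θ‖) := by
  have hc : Continuous fun θ : ℝ => ‖iteratedDeriv j φ θ‖ :=
    (φ.contDiff.continuous_iteratedDeriv j (by exact_mod_cast le_top)).norm
  have hp : Function.Periodic (fun θ : ℝ => ‖iteratedDeriv j φ θ‖) (2 * Real.pi) := by
    intro θ
    have h := congrFun (iteratedDeriv_comp_add_const j (φ : ℝ → ℂ) (2 * Real.pi)) θ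
    have h2 : (fun z : ℝ => φ (z + 2 * Real.pi)) = φ := funext φ.periodic
    rw [h2] at h
    simp only [← h]
  exact (hp.compact_of_continuous (by positivity) hc).bddAbove

/-- The seminorms `φ ↦ sup_θ |φ^{(j)}(θ)|`, `j = 0, 1, 2, …`. -/
def seminormFamily : SeminormFamily ℂ CircleTest ℕ := fun j =>
  Seminorm.of (fun φ : CircleTest => ⨆ θ : ℝ, ‖iteratedDeriv j φ θ‖)
    (fun φ ψ => by
      refine ciSup_le fun θ => ?_
      have h1 : ContDiffAt ℝ j (φ : ℝ → ℂ) θ :=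
        (φ.contDiff.of_le (by exact_mod_cast le_top)).contDiffAt
      have h2 : ContDiffAt ℝ j (ψ : ℝ → ℂ) θ :=
        (ψ.contDiff.of_le (by exact_mod_cast le_top)).contDiffAt
      rw [coe_add, iteratedDeriv_add h1 h2]
      exact (norm_add_le _ _).trans (add_le_add
        (le_ciSup (φ.bddAbove_iteratedDeriv j) θ) (le_ciSup (ψ.bddAbove_iteratedDeriv j) θ)))
    (fun c φ => by
      have h : ∀ θ, ‖iteratedDeriv j (c • φ : CircleTest) θ‖ = ‖c‖ * ‖iteratedDeriv j φ θ‖ := by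
        intro θ
        rw [coe_smul, iteratedDeriv_const_smul_field, norm_smul]
      simp only [h]
      exact (Real.mul_iSup_of_nonneg (norm_nonneg c) _).symm)

/-- The usual Fréchet topology of `C^∞(𝕊¹)`: uniform convergence of all derivatives. -/
instance instTopologicalSpace : TopologicalSpace CircleTest :=
  seminormFamily.moduleFilterBasis.topology

theorem withSeminorms : WithSeminorms seminormFamily := ⟨rfl⟩

/-- The test function `θ ↦ e^{imθ}`, `m ∈ ℤ`. -/
def mode (m : ℤ) : CircleTest :=
  ⟨fun θ => Complex.exp (Complex.I * m * θ), by
    constructor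
    · exact (contDiff_const.mul Complex.ofRealCLM.contDiff).cexp
    · intro θ
      have h : Complex.I * m * ((θ + 2 * Real.pi : ℝ) : ℂ)
          = Complex.I * m * θ + m * (2 * Real.pi * Complex.I) := by
        push_cast; ring
      simp only [h]
      exact Complex.exp_periodic.int_mul m _⟩

end CircleTest

/-- `𝒟'(𝕊¹)`: the topological dual of `C^∞(𝕊¹)`. -/
abbrev CircleDistribution : Type := CircleTest →L[ℂ] ℂ

/-- The Fourier coefficients `f̂_m = (1/2π) (f | e^{-imθ})` of a distribution on the circle; if
`f` is a function, acting by `φ ↦ ∫₀^{2π} f φ dθ`, these are its usual Fourier coefficients. -/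
def CircleDistribution.fourierCoeff (f : CircleDistribution) (m : ℤ) : ℂ :=
  (1 / (2 * Real.pi) : ℂ) * f (CircleTest.mode (-m))

/-! ### The regular solutions of the perturbed Bessel equations for `d = 2` -/

/-- The kernel `𝓛_ℓ(r,s)` for `ℓ = m - 1/2`; the case `m = 0`, i.e. `ℓ = -1/2`, is the
logarithmic one. -/
def besselKernel (m : ℕ) (r s : ℝ) : ℝ :=
  if m = 0 then Real.sqrt (r * s) * Real.log (r / s)
  else 1 / (2 * (m : ℝ)) *
    (r ^ ((m : ℝ) + 1 / 2) / s ^ ((m : ℝ) - 1 / 2) - s ^ ((m : ℝ) + 1 / 2) / r ^ ((m : ℝ) - 1 / 2))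

/-- The recursive integrals `ψ_0(r) = r^{m+1/2}`, `ψ_k(r) = ∫_0^r 𝓛_{m-1/2}(r,s) V(s) ψ_{k-1}(s) ds`. -/
def besselPsi (V : ℝ → ℂ) (m : ℕ) : ℕ → ℝ → ℂ
  | 0 => fun r => ((r ^ ((m : ℝ) + 1 / 2) : ℝ) : ℂ)
  | k + 1 => fun r => ∫ s in (0 : ℝ)..r, (besselKernel m r s : ℂ) * V s * besselPsi V m k s

/-- The regular solution `y_m = ∑_k ψ_k` on `(0,1]` of
`-y'' + (m² - 1/4) r⁻² y + V(r) y = 0`, with `y_m(r) ∼ r^{m+1/2}` as `r → 0⁺`. -/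
def besselSol (V : ℝ → ℂ) (m : ℕ) (r : ℝ) : ℂ := ∑' k : ℕ, besselPsi V m k r

/-- `α_m(r) = y_m(r) / r^{m+1/2}` for `0 < r ≤ 1`, and `α_m(0) = 1`. -/
def radialAlpha (V : ℝ → ℂ) (m : ℕ) (r : ℝ) : ℂ :=
  if r = 0 then 1 else besselSol V m r / ((r ^ ((m : ℝ) + 1 / 2) : ℝ) : ℂ)

/-! ### The series `u_f` -/

/-- The `m`-th term of `u_f` at the point with polar coordinates `(r, θ)`. -/
def poissonTerm (V : ℝ → ℂ) (f : CircleDistribution) (r θ : ℝ) (m : ℤ) : ℂ :=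
  (r : ℂ) ^ m.natAbs * radialAlpha V m.natAbs r / radialAlpha V m.natAbs 1
    * f.fourierCoeff m * Complex.exp (Complex.I * m * θ)

/-- The function `u_f` on the unit disk of `ℝ² = ℂ`, with `r = |z|` and `θ = arg z`. -/
def poissonSeries (V : ℝ → ℂ) (f : CircleDistribution) (z : ℂ) : ℂ :=
  ∑' m : ℤ, poissonTerm V f ‖z‖ z.arg m

/-! ### Distributional solutions and distributional boundary values -/

/-- `u ∈ L¹_loc(𝔹²)` is a distributional solution of `-Δu + V(|x|) u = 0` in the open unit disk
(`ℂ` is the Euclidean plane, `Δ` its Laplacian); the integral has to exist. -/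
def IsDistributionalSolution (V : ℝ → ℂ) (u : ℂ → ℂ) : Prop :=
  LocallyIntegrableOn u (Metric.ball (0 : ℂ) 1) volume ∧
    ∀ φ : ℂ → ℂ, ContDiff ℝ ∞ φ → HasCompactSupport φ → tsupport φ ⊆ Metric.ball (0 : ℂ) 1 →
      IntegrableOn (fun x => u x * (-(Laplacian.laplacian φ x) + V ‖x‖ * φ x))
        (Metric.ball (0 : ℂ) 1) volume ∧
      ∫ x in Metric.ball (0 : ℂ) 1,
        u x * (-(Laplacian.laplacian φ x) + V ‖x‖ * φ x) = 0

/-- The locally integrable function `u` on the open unit disk has the distributional boundary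
value `f`: its traces `u(r·)` are integrable on the circle for `r < 1` near `1` and converge to `f`
in `𝒟'(𝕊¹)` as `r → 1⁻`. -/
def HasDistributionalBoundaryValue (u : ℂ → ℂ) (f : CircleDistribution) : Prop :=
  LocallyIntegrableOn u (Metric.ball (0 : ℂ) 1) volume ∧
    (∀ᶠ r in 𝓝[<] (1 : ℝ),
      IntervalIntegrable (fun θ : ℝ => u (circleMap 0 r θ)) volume 0 (2 * Real.pi)) ∧
    ∀ φ : CircleTest,
      Tendsto (fun r : ℝ => ∫ θ in (0 : ℝ)..(2 * Real.pi), u (circleMap 0 r θ) * φ θ)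
        (𝓝[<] (1 : ℝ)) (𝓝 (f φ))

end

/-! Dividing by `r^(m+1/2)` turns the recursion for the regular solution into a Volterra equation
`α_m(r) = 1 + ∫ κ_m(r,s) V(s) α_m(s) ds`, where `κ_m(r,s) = s (1 - (s/r)^(2m)) / (2m)` for `s < r`,
with `-s log(s/r)` when `m = 0`. On the unit interval `0 ≤ κ_m(r,s) ≤ s (1 - log s)`, whatever `m`
and `r`. The iterates are therefore bounded by `W^k / k!`, where `W` is the total mass of the
weight, and `α_m` is bounded by `exp W` uniformly in `m` and `r` (`norm_radialAlpha_le`). For `m ≥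
1` the kernel also gains a factor `1/(2m)`, so `α_m(1) → 1`; as no `α_m(1)` vanishes, they stay away
from zero uniformly (`exists_pos_le_norm_radialAlpha_one`). The coefficients of `f` grow
polynomially by continuity of `f`. Hence the terms of `u_f` are at most `C r^|m| (1+|m|)^N`, which
gives absolute convergence, uniformly on smaller disks.

The equation is checked mode by mode without differentiating `α_m`. In polar coordinates `Δφ` enters
through its angular coefficients. The integral equation is inserted for `α_m` and the order of
integration exchanged, which leaves two identities for `φ` alone: the harmonic function `r^|m|
e^(imθ)` is orthogonal to `Δφ`, and `r^|m| besselRatio |m| (s/r)` is a Green function of the radial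
operator (`integral_besselRatio_mul_angularCoeff_laplacian`). Together they give
`integral_radialAlpha_mul_angularCoeff`; dominated convergence then sums the modes.

For the boundary value, pairing `u_f(r,·)` with `φ` gives `∑ (r^|m| α_|m|(r) / α_|m|(1)) · 2π f̂_m
φ̂_(-m)`. The quotients are bounded uniformly and tend to `1`, and `φ̂` decays rapidly, so the limit
is `∑ 2π f̂_m φ̂_(-m)`. This equals `(f | φ)` because the Fourier series of `φ` converges in the
Fréchet topology (`CircleTest.hasSum_coeff_smul_mode`). -/

noncomputable section

/-! ### The normalized Volterra equation -/

/-- `(1 - t^{2m}) / (2m)`, which is `-log t` for `m = 0`. -/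
def besselRatio (m : ℕ) (t : ℝ) : ℝ :=
  if m = 0 then -Real.log t else (1 - t ^ (2 * m)) / (2 * m)

theorem besselRatio_nonneg (m : ℕ) {t : ℝ} (h0 : 0 < t) (h1 : t ≤ 1) : 0 ≤ besselRatio m t := by
  unfold besselRatio
  split_ifs with hm
  · exact neg_nonneg.2 (Real.log_nonpos h0.le h1)
  · have : t ^ (2 * m) ≤ 1 := pow_le_one₀ h0.le h1
    exact div_nonneg (by linarith) (by positivity)

/-- The inequality `log x ≤ x - 1` at `x = t^(2m)`: the logarithmic case dominates all the others,
which makes the later estimates uniform in `m`. -/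
theorem besselRatio_le_neg_log (m : ℕ) {t : ℝ} (h0 : 0 < t) : besselRatio m t ≤ -Real.log t := by
  unfold besselRatio
  split_ifs with hm
  · exact le_rfl
  · have h := Real.log_le_sub_one_of_pos (pow_pos h0 (2 * m))
    rw [Real.log_pow] at h
    have hm' : (0 : ℝ) < m := by exact_mod_cast Nat.pos_of_ne_zero hm
    rw [div_le_iff₀ (by positivity)]
    push_cast at h
    linarith

theorem besselRatio_le_one_div {m : ℕ} (hm : m ≠ 0) {t : ℝ} (h0 : 0 < t) :
    besselRatio m t ≤ 1 / (2 * m) := by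
  have hm' : (0 : ℝ) < m := by exact_mod_cast Nat.pos_of_ne_zero hm
  rw [besselRatio, if_neg hm]
  gcongr
  have := pow_pos h0 (2 * m)
  linarith

theorem besselRatio_one (m : ℕ) : besselRatio m 1 = 0 := by
  unfold besselRatio
  split_ifs <;> simp

theorem continuousOn_besselRatio (m : ℕ) : ContinuousOn (besselRatio m) (Ioi 0) := by
  unfold besselRatio
  split_ifs with hm
  · exact (Real.continuousOn_log.mono fun x hx => (ne_of_gt hx : x ≠ 0)).neg
  · fun_prop

/-- The kernel of the integral equation satisfied by `α_m`. -/
def volterraKernel (m : ℕ) (r s : ℝ) : ℝ := s * besselRatio m (min (s / r) 1)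

theorem volterraKernel_nonneg (m : ℕ) {r s : ℝ} (hr : 0 < r) (hs : 0 < s) :
    0 ≤ volterraKernel m r s :=
  mul_nonneg hs.le (besselRatio_nonneg m (lt_min (by positivity) one_pos) (min_le_right _ _))

/-- The truncation by `min` makes the kernel continuous across the diagonal and zero beyond it. The
Volterra operator can then integrate over the fixed interval `(0,1)`, with no moving endpoint in
continuity and Fubini arguments. -/
theorem volterraKernel_eq_zero (m : ℕ) {r s : ℝ} (hr : 0 < r) (h : r ≤ s) :
    volterraKernel m r s = 0 := by
  rw [volterraKernel, min_eq_right ((one_le_div hr).2 h), besselRatio_one, mul_zero]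

/-- Since `r ≤ 1`, the truncated ratio is at least `s`, so its logarithm is at least `log s`; the
bound no longer depends on `r` or `m`. -/
theorem volterraKernel_le (m : ℕ) {r s : ℝ} (hr : r ∈ Ioc (0 : ℝ) 1) (hs : s ∈ Ioo (0 : ℝ) 1) :
    volterraKernel m r s ≤ s * (1 - Real.log s) := by
  refine mul_le_mul_of_nonneg_left ?_ hs.1.le
  have ht : 0 < min (s / r) 1 := lt_min (div_pos hs.1 hr.1) one_pos
  have h1 : s ≤ min (s / r) 1 := le_min (le_div_self hs.1.le hr.1 hr.2) hs.2.le
  have := Real.log_le_log hs.1 h1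
  linarith [besselRatio_le_neg_log m ht]

/-- Source of the decay in `m`. The factor `1 - log s ≥ 1` is inserted only to match the integrable
weight. -/
theorem volterraKernel_le_div {m : ℕ} (hm : m ≠ 0) {r s : ℝ} (hr : 0 < r)
    (hs : s ∈ Ioo (0 : ℝ) 1) :
    volterraKernel m r s ≤ s * (1 - Real.log s) / (2 * m) := by
  have hm' : (0 : ℝ) < m := by exact_mod_cast Nat.pos_of_ne_zero hm
  have ht : 0 < min (s / r) 1 := lt_min (div_pos hs.1 hr) one_pos
  have h := Real.log_nonpos hs.1.le hs.2.le
  calc volterraKernel m r s ≤ s * (1 / (2 * m)) :=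
        mul_le_mul_of_nonneg_left (besselRatio_le_one_div hm ht) hs.1.le
    _ = s * 1 / (2 * m) := by ring
    _ ≤ _ := by
        have := hs.1.le
        gcongr
        linarith

theorem continuousOn_volterraKernel (m : ℕ) :
    ContinuousOn (fun p : ℝ × ℝ => volterraKernel m p.1 p.2) (Ioi 0 ×ˢ Ioi 0) := by
  unfold volterraKernel
  refine continuousOn_snd.mul ((continuousOn_besselRatio m).comp ?_ ?_)
  · have h : ContinuousOn (fun p : ℝ × ℝ => p.2 / p.1) (Ioi 0 ×ˢ Ioi 0) :=
      continuousOn_snd.div continuousOn_fst fun p hp => ne_of_gt (mem_Ioi.1 hp.1)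
    exact h.inf continuousOn_const
  · intro p hp
    exact lt_min (div_pos (mem_Ioi.1 hp.2) (mem_Ioi.1 hp.1)) one_pos

/-- Conjugating the Bessel kernel by `r^(m+1/2)` removes the half-integer powers; this links the
given recursion to the normalized one. -/
theorem besselKernel_mul_rpow (m : ℕ) {r s : ℝ} (hs : 0 < s) (hsr : s ≤ r) :
    besselKernel m r s * s ^ ((m : ℝ) + 1 / 2) = r ^ ((m : ℝ) + 1 / 2) * volterraKernel m r s := by
  have hr : 0 < r := hs.trans_le hsr
  have hmin : min (s / r) 1 = s / r := min_eq_left ((div_le_one hr).2 hsr)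
  rw [besselKernel, volterraKernel, hmin, besselRatio]
  by_cases hm : m = 0
  · subst hm
    simp only [if_true, Nat.cast_zero, zero_add]
    rw [← Real.sqrt_eq_rpow, ← Real.sqrt_eq_rpow, Real.sqrt_mul hr.le,
      Real.log_div hr.ne' hs.ne', Real.log_div hs.ne' hr.ne']
    have := Real.mul_self_sqrt hs.le
    linear_combination (√r * (Real.log r - Real.log s)) * this
  · simp only [if_neg hm]
    have hm' : (0 : ℝ) < m := by exact_mod_cast Nat.pos_of_ne_zero hm
    have e1 : ∀ x : ℝ, 0 < x → x ^ ((m : ℝ) + 1 / 2) = x ^ m * √x := fun x hx => by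
      rw [Real.rpow_add hx, Real.rpow_natCast, Real.sqrt_eq_rpow]
    have e2 : ∀ x : ℝ, 0 < x → x ^ ((m : ℝ) - 1 / 2) = x ^ m / √x := fun x hx => by
      rw [Real.rpow_sub hx, Real.rpow_natCast, Real.sqrt_eq_rpow]
    rw [e1 r hr, e1 s hs, e2 r hr, e2 s hs]
    have h1 := Real.sq_sqrt hr.le
    have h2 := Real.sq_sqrt hs.le
    have h3 : 0 < √r := Real.sqrt_pos.2 hr
    have h4 : 0 < √s := Real.sqrt_pos.2 hs
    have hrm := pow_pos hr m
    have hsm := pow_pos hs m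
    rw [div_pow, pow_mul', pow_mul']
    field_simp
    rw [h2]
    ring

/-! ### The Neumann series of the Volterra equation and its estimates. -/

section Volterra

variable {V : ℝ → ℂ}

/-- The weight `s (1 - log s) |V(s)|`. -/
def logWeight (V : ℝ → ℂ) (s : ℝ) : ℝ := s * (1 - Real.log s) * ‖V s‖

theorem one_sub_log_ge {s : ℝ} (hs : s ∈ Ioo (0 : ℝ) 1) : 1 ≤ 1 - Real.log s := by
  have := Real.log_nonpos hs.1.le hs.2.le
  linarith

theorem logWeight_nonneg (V : ℝ → ℂ) {s : ℝ} (hs : s ∈ Ioo (0 : ℝ) 1) : 0 ≤ logWeight V s :=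
  mul_nonneg (mul_nonneg hs.1.le (zero_le_one.trans (one_sub_log_ge hs))) (norm_nonneg _)

theorem mul_norm_le_logWeight (V : ℝ → ℂ) {s : ℝ} (hs : s ∈ Ioo (0 : ℝ) 1) :
    s * ‖V s‖ ≤ logWeight V s := by
  refine mul_le_mul_of_nonneg_right ?_ (norm_nonneg _)
  nlinarith [one_sub_log_ge hs, hs.1]

theorem integrableOn_logWeight
    (hV : IntegrableOn (fun r : ℝ => ((r * (1 - Real.log r) : ℝ) : ℂ) * V r) (Ioo 0 1) volume) :
    IntegrableOn (logWeight V) (Ioo 0 1) volume := by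
  refine IntegrableOn.congr_fun hV.norm (fun s hs => ?_) measurableSet_Ioo
  rw [norm_mul, Complex.norm_real, Real.norm_of_nonneg]
  · rfl
  · exact mul_nonneg hs.1.le (zero_le_one.trans (one_sub_log_ge hs))

/-- The weight has no zero in `(0,1)`, so measurability of `V` there is recovered by dividing it
out. -/
theorem aestronglyMeasurable_potential
    (hV : IntegrableOn (fun r : ℝ => ((r * (1 - Real.log r) : ℝ) : ℂ) * V r) (Ioo 0 1) volume) :
    AEStronglyMeasurable V (volume.restrict (Ioo 0 1)) := by
  have h1 : AEStronglyMeasurable (fun r : ℝ => ((r * (1 - Real.log r) : ℝ) : ℂ)⁻¹)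
      (volume.restrict (Ioo 0 1)) := by
    apply Measurable.aestronglyMeasurable
    fun_prop
  refine (h1.mul hV.aestronglyMeasurable).congr ?_
  refine (ae_restrict_mem measurableSet_Ioo).mono fun s hs => ?_
  have : ((s * (1 - Real.log s) : ℝ) : ℂ) ≠ 0 := by
    have := one_sub_log_ge hs
    have := hs.1
    exact_mod_cast (by positivity : s * (1 - Real.log s) ≠ 0)
  simp only [Pi.mul_apply]
  rw [inv_mul_cancel_left₀ this]

/-- The Volterra operator `a ↦ ∫₀^r κ_m(r,s) V(s) a(s) ds`; the kernel vanishes for `s ≥ r`. -/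
def volterraOp (V : ℝ → ℂ) (m : ℕ) (a : ℝ → ℂ) (r : ℝ) : ℂ :=
  ∫ s in Ioo (0 : ℝ) 1, (volterraKernel m r s : ℂ) * V s * a s

theorem volterraOp_eq_Ioo (V : ℝ → ℂ) (m : ℕ) (a : ℝ → ℂ) {r : ℝ} (hr : r ∈ Ioc (0 : ℝ) 1) :
    volterraOp V m a r = ∫ s in Ioo (0 : ℝ) r, (volterraKernel m r s : ℂ) * V s * a s := by
  refine (setIntegral_eq_of_subset_of_forall_sdiff_eq_zero measurableSet_Ioo
    (Ioo_subset_Ioo_right hr.2) fun s hs => ?_)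
  have : r ≤ s := by
    by_contra! h
    exact hs.2 ⟨hs.1.1, h⟩
  rw [volterraKernel_eq_zero m hr.1 this]
  simp

theorem norm_volterraKernel_mul_le (V : ℝ → ℂ) (m : ℕ) {r s : ℝ} (hr : r ∈ Ioc (0 : ℝ) 1)
    (hs : s ∈ Ioo (0 : ℝ) 1) : ‖(volterraKernel m r s : ℂ) * V s‖ ≤ logWeight V s := by
  rw [norm_mul, Complex.norm_real, Real.norm_of_nonneg (volterraKernel_nonneg m hr.1 hs.1)]
  exact mul_le_mul_of_nonneg_right (volterraKernel_le m hr hs) (norm_nonneg _)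

theorem aestronglyMeasurable_volterraKernel (m : ℕ) {r : ℝ} (hr : 0 < r) :
    AEStronglyMeasurable (fun s => (volterraKernel m r s : ℂ)) (volume.restrict (Ioo 0 1)) := by
  refine ContinuousOn.aestronglyMeasurable ?_ measurableSet_Ioo
  refine Complex.continuous_ofReal.comp_continuousOn ?_
  exact (continuousOn_volterraKernel m).comp (by fun_prop : ContinuousOn (fun s : ℝ => (r, s)) _)
    fun s hs => ⟨hr, hs.1⟩

theorem continuousOn_volterraOp
    (hV : IntegrableOn (fun r : ℝ => ((r * (1 - Real.log r) : ℝ) : ℂ) * V r) (Ioo 0 1) volume)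
    (m : ℕ) {a : ℝ → ℂ} (ha : ContinuousOn a (Ioo 0 1)) {C : ℝ}
    (hC : ∀ s ∈ Ioo (0 : ℝ) 1, ‖a s‖ ≤ C) : ContinuousOn (volterraOp V m a) (Ioc 0 1) := by
  refine continuousOn_of_dominated (bound := fun s => logWeight V s * C) ?_ ?_ ?_ ?_
  · intro r hr
    exact ((aestronglyMeasurable_volterraKernel m hr.1).mul
      (aestronglyMeasurable_potential hV)).mul (ha.aestronglyMeasurable measurableSet_Ioo)
  · intro r hr
    refine (ae_restrict_mem measurableSet_Ioo).mono fun s hs => ?_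
    rw [norm_mul]
    exact mul_le_mul (norm_volterraKernel_mul_le V m hr hs) (hC s hs) (norm_nonneg _)
      (logWeight_nonneg V hs)
  · exact (integrableOn_logWeight hV).mul_const C
  · refine (ae_restrict_mem measurableSet_Ioo).mono fun s hs => ?_
    refine ContinuousOn.mul (ContinuousOn.mul ?_ continuousOn_const) continuousOn_const
    refine Complex.continuous_ofReal.comp_continuousOn ?_
    exact (continuousOn_volterraKernel m).comp (by fun_prop : ContinuousOn (fun r : ℝ => (r, s)) _)
      fun r hr => ⟨hr.1, hs.1⟩

/-- The iterates `ψ_k(r) / r^{m+1/2}`. -/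
def volterraIterate (V : ℝ → ℂ) (m : ℕ) : ℕ → ℝ → ℂ
  | 0 => fun _ => 1
  | k + 1 => volterraOp V m (volterraIterate V m k)

theorem besselPsi_eq (V : ℝ → ℂ) (m k : ℕ) {r : ℝ} (hr : r ∈ Ioc (0 : ℝ) 1) :
    besselPsi V m k r = ((r ^ ((m : ℝ) + 1 / 2) : ℝ) : ℂ) * volterraIterate V m k r := by
  induction k generalizing r with
  | zero => simp [besselPsi, volterraIterate]
  | succ k ih =>
    rw [volterraIterate, volterraOp_eq_Ioo V m _ hr]
    simp only [besselPsi]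
    rw [intervalIntegral.integral_of_le hr.1.le, integral_Ioc_eq_integral_Ioo,
      ← integral_const_mul]
    refine setIntegral_congr_fun measurableSet_Ioo fun s hs => ?_
    rw [ih ⟨hs.1, hs.2.le.trans hr.2⟩]
    have h := besselKernel_mul_rpow m hs.1 hs.2.le
    have h' : (besselKernel m r s : ℂ) * ((s ^ ((m : ℝ) + 1 / 2) : ℝ) : ℂ)
        = ((r ^ ((m : ℝ) + 1 / 2) : ℝ) : ℂ) * (volterraKernel m r s : ℂ) := by
      exact_mod_cast h
    linear_combination (V s * volterraIterate V m k s) * h'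

theorem radialAlpha_eq_tsum (V : ℝ → ℂ) (m : ℕ) {r : ℝ} (hr : r ∈ Ioc (0 : ℝ) 1) :
    radialAlpha V m r = ∑' k, volterraIterate V m k r := by
  have h0 : ((r ^ ((m : ℝ) + 1 / 2) : ℝ) : ℂ) ≠ 0 := by
    exact_mod_cast (Real.rpow_pos_of_pos hr.1 _).ne'
  rw [radialAlpha, if_neg hr.1.ne', besselSol]
  simp_rw [besselPsi_eq V m _ hr]
  rw [tsum_mul_left, mul_div_cancel_left₀ _ h0]

/-- The power rule for the primitive of an integrable function. -/
theorem integral_mul_primitive_pow {w : ℝ → ℝ} {a b : ℝ} (hw : IntervalIntegrable w volume a b)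
    (k : ℕ) :
    ∫ s in a..b, w s * (∫ t in a..s, w t) ^ k = (∫ t in a..b, w t) ^ (k + 1) / (k + 1) := by
  -- The primitive is differentiable only almost everywhere, so the fundamental theorem is applied
  -- to its powers through absolute continuity.
  have hac := hw.absolutelyContinuousOnInterval_intervalIntegral (c := a) left_mem_uIcc
  have hpow : ∀ n : ℕ, AbsolutelyContinuousOnInterval
      (fun s => (∫ t in a..s, w t) ^ (n + 1)) a b := by
    intro n
    induction n with
    | zero => simpa using hac
    | succ n ih => simpa only [pow_succ _ (n + 1)] using ih.fun_mul hac
  have h := (hpow k).integral_deriv_eq_sub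
  have h2 : ∫ s in a..b, deriv (fun s => (∫ t in a..s, w t) ^ (k + 1)) s
      = ∫ s in a..b, ((k : ℝ) + 1) * (w s * (∫ t in a..s, w t) ^ k) := by
    apply intervalIntegral.integral_congr_ae
    filter_upwards [hw.ae_hasDerivAt_integral] with x hx hx'
    have := (hx (uIoc_subset_uIcc hx') a left_mem_uIcc).fun_pow (k + 1)
    rw [this.deriv]
    push_cast
    ring
  rw [h2, intervalIntegral.integral_const_mul] at h
  simp only [intervalIntegral.integral_same] at h
  have hk : (0 : ℝ) < (k : ℝ) + 1 := by positivity
  rw [eq_div_iff hk.ne', mul_comm, h]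
  simp

theorem intervalIntegrable_logWeight
    (hV : IntegrableOn (fun r : ℝ => ((r * (1 - Real.log r) : ℝ) : ℂ) * V r) (Ioo 0 1) volume)
    {r : ℝ} (hr : r ∈ Icc (0 : ℝ) 1) : IntervalIntegrable (logWeight V) volume 0 r := by
  rw [intervalIntegrable_iff_integrableOn_Ioo_of_le hr.1]
  exact (integrableOn_logWeight hV).mono_set (Ioo_subset_Ioo_right hr.2)

/-- `∫₀^r s (1 - log s) |V(s)| ds`. -/
def logMass (V : ℝ → ℂ) (r : ℝ) : ℝ := ∫ s in (0 : ℝ)..r, logWeight V s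

theorem logMass_mono
    (hV : IntegrableOn (fun r : ℝ => ((r * (1 - Real.log r) : ℝ) : ℂ) * V r) (Ioo 0 1) volume)
    {r : ℝ} (hr : r ∈ Icc (0 : ℝ) 1) : logMass V r ≤ logMass V 1 := by
  have h1 : (0 : ℝ) ≤ 1 := zero_le_one
  rw [logMass, logMass, intervalIntegral.integral_of_le hr.1, intervalIntegral.integral_of_le h1,
    integral_Ioc_eq_integral_Ioo, integral_Ioc_eq_integral_Ioo]
  refine setIntegral_mono_set (integrableOn_logWeight hV) ?_
    (Ioo_subset_Ioo_right hr.2).eventuallyLE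
  exact (ae_restrict_mem measurableSet_Ioo).mono fun s hs => logWeight_nonneg V hs

theorem logMass_nonneg (V : ℝ → ℂ) {r : ℝ} (hr : r ∈ Icc (0 : ℝ) 1) : 0 ≤ logMass V r := by
  rw [logMass, intervalIntegral.integral_of_le hr.1, integral_Ioc_eq_integral_Ioo]
  exact setIntegral_nonneg measurableSet_Ioo
    fun s hs => logWeight_nonneg V ⟨hs.1, hs.2.trans_le hr.2⟩

/-- Each kernel is dominated by the weight, whose primitive is `logMass`; integrating `w W^k / k!`
gives `W^(k+1) / (k+1)!`, as for an iterated integral over a simplex. -/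
theorem norm_volterraIterate_le
    (hV : IntegrableOn (fun r : ℝ => ((r * (1 - Real.log r) : ℝ) : ℂ) * V r) (Ioo 0 1) volume)
    (m k : ℕ) {r : ℝ} (hr : r ∈ Ioc (0 : ℝ) 1) :
    ‖volterraIterate V m k r‖ ≤ logMass V r ^ k / k.factorial := by
  induction k generalizing r with
  | zero => simp [volterraIterate]
  | succ k ih =>
    have hint := intervalIntegrable_logWeight hV (Ioc_subset_Icc_self hr)
    have hcont : ContinuousOn (logMass V) (uIcc 0 r) :=
      (hint.absolutelyContinuousOnInterval_intervalIntegral left_mem_uIcc).continuousOn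
    have hint2 : IntervalIntegrable (fun s => logWeight V s * (logMass V s ^ k / k.factorial))
        volume 0 r := hint.mul_continuousOn ((hcont.pow k).div_const _)
    rw [volterraIterate, volterraOp_eq_Ioo V m _ hr]
    calc _ ≤ ∫ s in Ioo (0 : ℝ) r, logWeight V s * (logMass V s ^ k / k.factorial) := by
          refine norm_integral_le_of_norm_le
            ((intervalIntegrable_iff_integrableOn_Ioo_of_le hr.1.le).1 hint2) ?_
          refine (ae_restrict_mem measurableSet_Ioo).mono fun s hs => ?_
          have hs' : s ∈ Ioo (0 : ℝ) 1 := ⟨hs.1, hs.2.trans_le hr.2⟩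
          rw [norm_mul]
          exact mul_le_mul (norm_volterraKernel_mul_le V m hr hs') (ih (Ioo_subset_Ioc_self hs'))
            (norm_nonneg _) (logWeight_nonneg V hs')
      _ = ∫ s in (0 : ℝ)..r, (logWeight V s * logMass V s ^ k) / k.factorial := by
          rw [intervalIntegral.integral_of_le hr.1.le, integral_Ioc_eq_integral_Ioo]
          simp_rw [mul_div_assoc]
      _ = logMass V r ^ (k + 1) / (k + 1).factorial := by
          rw [intervalIntegral.integral_div]
          unfold logMass
          rw [integral_mul_primitive_pow hint k, Nat.factorial_succ, div_div]
          push_cast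
          ring

theorem norm_volterraIterate_le'
    (hV : IntegrableOn (fun r : ℝ => ((r * (1 - Real.log r) : ℝ) : ℂ) * V r) (Ioo 0 1) volume)
    (m k : ℕ) {r : ℝ} (hr : r ∈ Ioc (0 : ℝ) 1) :
    ‖volterraIterate V m k r‖ ≤ logMass V 1 ^ k / k.factorial := by
  refine (norm_volterraIterate_le hV m k hr).trans ?_
  have h0 := logMass_nonneg V (Ioc_subset_Icc_self hr)
  have := logMass_mono hV (Ioc_subset_Icc_self hr)
  gcongr

theorem continuousOn_volterraIterate
    (hV : IntegrableOn (fun r : ℝ => ((r * (1 - Real.log r) : ℝ) : ℂ) * V r) (Ioo 0 1) volume)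
    (m k : ℕ) : ContinuousOn (volterraIterate V m k) (Ioc 0 1) := by
  induction k with
  | zero => exact continuousOn_const
  | succ k ih =>
    exact continuousOn_volterraOp hV m (ih.mono Ioo_subset_Ioc_self)
      fun s hs => norm_volterraIterate_le' hV m k (Ioo_subset_Ioc_self hs)

theorem continuousOn_radialAlpha
    (hV : IntegrableOn (fun r : ℝ => ((r * (1 - Real.log r) : ℝ) : ℂ) * V r) (Ioo 0 1) volume)
    (m : ℕ) : ContinuousOn (radialAlpha V m) (Ioc 0 1) := by
  refine ContinuousOn.congr ?_ fun r hr => radialAlpha_eq_tsum V m hr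
  exact continuousOn_tsum (fun k => continuousOn_volterraIterate hV m k)
    (Real.summable_pow_div_factorial (logMass V 1))
    fun k r hr => norm_volterraIterate_le' hV m k hr

theorem norm_radialAlpha_le
    (hV : IntegrableOn (fun r : ℝ => ((r * (1 - Real.log r) : ℝ) : ℂ) * V r) (Ioo 0 1) volume)
    (m : ℕ) {r : ℝ} (hr : r ∈ Icc (0 : ℝ) 1) :
    ‖radialAlpha V m r‖ ≤ Real.exp (logMass V 1) := by
  rcases hr.1.eq_or_lt with h | h
  · rw [← h, radialAlpha, if_pos rfl, norm_one]
    exact Real.one_le_exp (logMass_nonneg V ⟨zero_le_one, le_rfl⟩)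
  · have hr' : r ∈ Ioc (0 : ℝ) 1 := ⟨h, hr.2⟩
    rw [radialAlpha_eq_tsum V m hr']
    refine tsum_of_norm_bounded ?_ fun k => norm_volterraIterate_le' hV m k hr'
    rw [Real.exp_eq_exp_ℝ]
    exact NormedSpace.expSeries_div_hasSum_exp _

/-- The integral equation for `α_m`. -/
theorem radialAlpha_eq_one_add
    (hV : IntegrableOn (fun r : ℝ => ((r * (1 - Real.log r) : ℝ) : ℂ) * V r) (Ioo 0 1) volume)
    (m : ℕ) {r : ℝ} (hr : r ∈ Ioc (0 : ℝ) 1) :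
    radialAlpha V m r = 1 + volterraOp V m (radialAlpha V m) r := by
  have hsum : ∀ s ∈ Ioc (0 : ℝ) 1, Summable fun k => volterraIterate V m k s := fun s hs =>
    .of_norm_bounded (Real.summable_pow_div_factorial (logMass V 1))
      fun k => norm_volterraIterate_le' hV m k hs
  rw [radialAlpha_eq_tsum V m hr, (hsum r hr).tsum_eq_zero_add]
  congr 1
  -- Sum and integral are exchanged with the exponential series times the weight as majorant.
  refine HasSum.tsum_eq ?_
  refine hasSum_integral_of_dominated_convergence
    (bound := fun k s => logWeight V s * (logMass V 1 ^ k / k.factorial)) ?_ ?_ ?_ ?_ ?_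
  · intro k
    exact ((aestronglyMeasurable_volterraKernel m hr.1).mul
      (aestronglyMeasurable_potential hV)).mul
      (((continuousOn_volterraIterate hV m k).mono Ioo_subset_Ioc_self).aestronglyMeasurable
        measurableSet_Ioo)
  · intro k
    refine (ae_restrict_mem measurableSet_Ioo).mono fun s hs => ?_
    rw [norm_mul]
    exact mul_le_mul (norm_volterraKernel_mul_le V m hr hs)
      (norm_volterraIterate_le' hV m k (Ioo_subset_Ioc_self hs)) (norm_nonneg _)
      (logWeight_nonneg V hs)
  · exact Eventually.of_forall fun s =>
      (Real.summable_pow_div_factorial (logMass V 1)).mul_left _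
  · simp_rw [tsum_mul_left]
    exact (integrableOn_logWeight hV).mul_const _
  · refine (ae_restrict_mem measurableSet_Ioo).mono fun s hs => ?_
    rw [radialAlpha_eq_tsum V m (Ioo_subset_Ioc_self hs)]
    exact (hsum s (Ioo_subset_Ioc_self hs)).hasSum.mul_left _

/-! ### A lower bound for `|α_m(1)|` uniform in `m`. -/

theorem norm_radialAlpha_one_sub_one_le
    (hV : IntegrableOn (fun r : ℝ => ((r * (1 - Real.log r) : ℝ) : ℂ) * V r) (Ioo 0 1) volume)
    {m : ℕ} (hm : m ≠ 0) :
    ‖radialAlpha V m 1 - 1‖ ≤ (∫ s in Ioo (0 : ℝ) 1, logWeight V s * Real.exp (logMass V 1)) / (2 * m) := by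
  rw [radialAlpha_eq_one_add hV m ⟨one_pos, le_rfl⟩, add_sub_cancel_left, ← integral_div]
  refine norm_integral_le_of_norm_le (((integrableOn_logWeight hV).mul_const _).div_const _) ?_
  refine (ae_restrict_mem measurableSet_Ioo).mono fun s hs => ?_
  rw [norm_mul, norm_mul, Complex.norm_real,
    Real.norm_of_nonneg (volterraKernel_nonneg m one_pos hs.1), mul_div_right_comm]
  have h := volterraKernel_le_div hm one_pos hs
  refine mul_le_mul ?_ (norm_radialAlpha_le hV m (Ioo_subset_Icc_self hs)) (norm_nonneg _)
    (div_nonneg (logWeight_nonneg V hs) (by positivity))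
  rw [logWeight, mul_div_right_comm]
  exact mul_le_mul_of_nonneg_right h (norm_nonneg _)

theorem exists_pos_le_norm_radialAlpha_one
    (hV : IntegrableOn (fun r : ℝ => ((r * (1 - Real.log r) : ℝ) : ℂ) * V r) (Ioo 0 1) volume)
    (hα : ∀ m : ℕ, radialAlpha V m 1 ≠ 0) : ∃ c > 0, ∀ m : ℕ, c ≤ ‖radialAlpha V m 1‖ := by
  have hlim : Tendsto (fun m => radialAlpha V m 1) atTop (𝓝 1) := by
    rw [tendsto_iff_norm_sub_tendsto_zero]
    refine squeeze_zero' (Eventually.of_forall fun m => norm_nonneg _)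
      ((eventually_ne_atTop 0).mono fun m hm => norm_radialAlpha_one_sub_one_le hV hm) ?_
    exact tendsto_const_nhds.div_atTop
      (Tendsto.const_mul_atTop two_pos tendsto_natCast_atTop_atTop)
  -- From `N` on the norms are at least `1/2`; the finitely many remaining indices contribute a
  -- positive minimum by nonvanishing.
  obtain ⟨N, hN⟩ := eventually_atTop.1
    (hlim.norm.eventually_const_le (by norm_num : (1 / 2 : ℝ) < ‖(1 : ℂ)‖))
  obtain ⟨j, -, hj⟩ := (Finset.range (N + 1)).exists_min_image (fun m => ‖radialAlpha V m 1‖)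
    ⟨0, by simp⟩
  refine ⟨min (1 / 2) ‖radialAlpha V j 1‖, lt_min (by norm_num) (norm_pos_iff.2 (hα j)), ?_⟩
  intro m
  rcases le_total N m with h | h
  · exact (min_le_left _ _).trans (hN m h)
  · exact (min_le_right _ _).trans (hj m (by simp; omega))

end Volterra

/-! ### Fourier series of test functions on the circle -/

namespace CircleTest

@[ext]
theorem ext {φ ψ : CircleTest} (h : ∀ θ, φ θ = ψ θ) : φ = ψ := Subtype.ext (funext h)

theorem mode_apply (m : ℤ) (θ : ℝ) : mode m θ = Complex.exp (Complex.I * m * θ) := rfl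

theorem norm_exp_mode (m : ℤ) (θ : ℝ) : ‖Complex.exp (Complex.I * m * θ)‖ = 1 := by
  rw [show Complex.I * m * θ = ((m * θ : ℝ) : ℂ) * Complex.I by push_cast; ring]
  exact Complex.norm_exp_ofReal_mul_I _

theorem hasDerivAt_exp_mode (m : ℤ) (θ : ℝ) :
    HasDerivAt (fun θ : ℝ => Complex.exp (Complex.I * m * θ))
      (Complex.I * m * Complex.exp (Complex.I * m * θ)) θ := by
  have h : HasDerivAt (fun θ : ℝ => Complex.I * m * (θ : ℂ)) (Complex.I * m * 1) θ :=
    (Complex.ofRealCLM.hasDerivAt (x := θ)).const_mul _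
  convert! h.cexp using 1
  ring

theorem continuous (φ : CircleTest) : Continuous (φ : ℝ → ℂ) := φ.contDiff.continuous

theorem differentiable (φ : CircleTest) : Differentiable ℝ (φ : ℝ → ℂ) :=
  φ.contDiff.differentiable (by simp)

theorem exists_norm_le (φ : CircleTest) : ∃ C, ∀ θ, ‖φ θ‖ ≤ C := by
  obtain ⟨C, hC⟩ := φ.bddAbove_iteratedDeriv 0
  exact ⟨C, fun θ => by simpa using hC ⟨θ, rfl⟩⟩

/-- Differentiation with respect to the angle. -/
def derivative : CircleTest →ₗ[ℂ] CircleTest where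
  toFun φ := ⟨deriv φ, (contDiff_infty_iff_deriv.1 φ.contDiff).2, fun θ => by
    rw [← deriv_comp_add_const]
    congr 1
    exact funext φ.periodic⟩
  map_add' φ ψ := ext fun θ => deriv_add (φ.differentiable θ) (ψ.differentiable θ)
  map_smul' c φ := ext fun θ => deriv_const_smul c (φ.differentiable θ)

theorem iteratedDeriv_eq (φ : CircleTest) (j : ℕ) (θ : ℝ) :
    iteratedDeriv j φ θ = (derivative ^ j) φ θ := by
  induction j generalizing φ with
  | zero => simp
  | succ j ih =>
    rw [iteratedDeriv_succ', pow_succ]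
    exact ih (derivative φ)

/-- Expressing the seminorms through powers of a linear map lets them pass through finite sums of
modes. -/
theorem seminormFamily_apply (φ : CircleTest) (j : ℕ) :
    seminormFamily j φ = ⨆ θ : ℝ, ‖(derivative ^ j) φ θ‖ :=
  congrArg iSup (funext fun θ => congrArg norm (iteratedDeriv_eq φ j θ))

theorem derivative_mode (m : ℤ) : derivative (mode m) = (Complex.I * m) • mode m :=
  ext fun θ => (hasDerivAt_exp_mode m θ).deriv

theorem derivative_pow_mode (m : ℤ) (j : ℕ) :
    (derivative ^ j) (mode m) = (Complex.I * m) ^ j • mode m := by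
  induction j with
  | zero => simp
  | succ j ih =>
    rw [pow_succ', Module.End.mul_apply, ih, map_smul, derivative_mode, smul_smul, pow_succ]

/-- The Fourier coefficients of a test function. -/
def coeff (φ : CircleTest) (m : ℤ) : ℂ :=
  (1 / (2 * Real.pi) : ℂ) * ∫ θ in (0 : ℝ)..(2 * Real.pi), Complex.exp (Complex.I * (-m : ℤ) * θ) * φ θ

/-- Integration by parts; the boundary terms cancel by periodicity. -/
theorem coeff_derivative (φ : CircleTest) (m : ℤ) :
    coeff (derivative φ) m = Complex.I * m * coeff φ m := by
  have h := intervalIntegral.integral_mul_deriv_eq_deriv_mul (a := 0) (b := 2 * Real.pi)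
    (u := fun θ : ℝ => Complex.exp (Complex.I * (-m : ℤ) * θ)) (v := φ) (v' := derivative φ)
    (fun θ _ => hasDerivAt_exp_mode (-m) θ) (fun θ _ => (φ.differentiable θ).hasDerivAt)
    (Continuous.intervalIntegrable (by fun_prop) _ _)
    ((derivative φ).continuous.intervalIntegrable _ _)
  have hper : Complex.exp (Complex.I * (-m : ℤ) * (2 * Real.pi : ℝ)) * φ (2 * Real.pi)
      - Complex.exp (Complex.I * (-m : ℤ) * (0 : ℝ)) * φ 0 = 0 := by
    have h1 := (mode (-m)).periodic 0
    have h2 := φ.periodic 0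
    rw [zero_add] at h1 h2
    rw [mode_apply, mode_apply] at h1
    rw [h1, h2, sub_self]
  rw [hper, zero_sub] at h
  rw [coeff, coeff, h]
  simp_rw [mul_assoc (Complex.I * ((-m : ℤ) : ℂ))]
  rw [intervalIntegral.integral_const_mul]
  push_cast
  ring

theorem coeff_derivative_pow (φ : CircleTest) (m : ℤ) (j : ℕ) :
    coeff ((derivative ^ j) φ) m = (Complex.I * m) ^ j * coeff φ m := by
  induction j with
  | zero => simp
  | succ j ih =>
    rw [pow_succ', Module.End.mul_apply, coeff_derivative, ih, pow_succ]
    ring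

theorem norm_coeff_le {φ : CircleTest} {C : ℝ} (hC : ∀ θ, ‖φ θ‖ ≤ C) (m : ℤ) :
    ‖coeff φ m‖ ≤ C := by
  have h := intervalIntegral.norm_integral_le_of_norm_le_const (a := 0) (b := 2 * Real.pi)
    (f := fun θ : ℝ => Complex.exp (Complex.I * (-m : ℤ) * θ) * φ θ) (C := C) fun θ _ => by
      rw [norm_mul, norm_exp_mode, one_mul]
      exact hC θ
  have hpi := Real.two_pi_pos
  rw [sub_zero, abs_of_pos hpi] at h
  rw [coeff, norm_mul, show (1 / (2 * Real.pi) : ℂ) = ((1 / (2 * Real.pi) : ℝ) : ℂ) by push_cast; rfl,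
    Complex.norm_real, Real.norm_of_nonneg (by positivity), one_div, inv_mul_le_iff₀ hpi]
  linarith

/-- Integrating by parts `k` times controls `|m|^k` times the coefficient. The constant `2^k` comes
from `1 + |m| ≤ 2 max(1, |m|)`. -/
theorem exists_pow_mul_norm_coeff_le (φ : CircleTest) (k : ℕ) :
    ∃ C, ∀ m : ℤ, (1 + |(m : ℝ)|) ^ k * ‖coeff φ m‖ ≤ C := by
  obtain ⟨A, hA⟩ := φ.exists_norm_le
  obtain ⟨B, hB⟩ := ((derivative ^ k) φ).exists_norm_le
  refine ⟨2 ^ k * (A + B), fun m => ?_⟩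
  have h1 := norm_coeff_le hA m
  have h2 := norm_coeff_le hB m
  rw [coeff_derivative_pow, norm_mul, norm_pow, norm_mul, Complex.norm_I, one_mul,
    Complex.norm_intCast] at h2
  have hA0 := (norm_nonneg _).trans h1
  have hB0 : 0 ≤ B := le_trans (by positivity) h2
  have h0 := abs_nonneg (m : ℝ)
  rcases le_total |(m : ℝ)| 1 with h | h
  · calc _ ≤ 2 ^ k * A := by
          gcongr
          linarith
      _ ≤ _ := by gcongr; linarith
  · calc _ ≤ (2 * |(m : ℝ)|) ^ k * ‖coeff φ m‖ := by
          gcongr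
          linarith
      _ = 2 ^ k * (|(m : ℝ)| ^ k * ‖coeff φ m‖) := by rw [mul_pow]; ring
      _ ≤ _ := by gcongr; linarith

theorem summable_one_add_abs_inv_sq : Summable fun m : ℤ => ((1 + |(m : ℝ)|) ^ 2)⁻¹ := by
  have h : Summable fun n : ℕ => ((1 + |((n : ℤ) : ℝ)|) ^ 2)⁻¹ := by
    have := (summable_nat_add_iff 1).2 (Real.summable_nat_pow_inv.2 one_lt_two)
    refine this.congr fun n => ?_
    rw [Int.cast_natCast, abs_of_nonneg (Nat.cast_nonneg n)]
    push_cast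
    rw [add_comm]
  refine Summable.of_nat_of_neg h ?_
  simpa using h

theorem summable_pow_mul_norm_coeff (φ : CircleTest) (k : ℕ) :
    Summable fun m : ℤ => (1 + |(m : ℝ)|) ^ k * ‖coeff φ m‖ := by
  obtain ⟨C, hC⟩ := φ.exists_pow_mul_norm_coeff_le (k + 2)
  refine Summable.of_nonneg_of_le (fun m => by positivity) (fun m => ?_)
    (summable_one_add_abs_inv_sq.mul_left C)
  have h0 : 0 < (1 + |(m : ℝ)|) ^ 2 := by positivity
  rw [← div_eq_mul_inv, le_div_iff₀ h0]
  refine le_trans (le_of_eq ?_) (hC m)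
  ring

theorem summable_norm_coeff (φ : CircleTest) : Summable fun m : ℤ => ‖coeff φ m‖ := by
  simpa using φ.summable_pow_mul_norm_coeff 0

theorem hasSum_coeff_mul_exp (φ : CircleTest) (θ : ℝ) :
    HasSum (fun m : ℤ => coeff φ m * Complex.exp (Complex.I * m * θ)) (φ θ) := by
  have : Fact (0 < 2 * Real.pi) := ⟨Real.two_pi_pos⟩
  let F : C(AddCircle (2 * Real.pi), ℂ) :=
    ⟨φ.periodic.lift, continuous_coinduced_dom.2 φ.continuous⟩
  have hpi : (Real.pi : ℂ) ≠ 0 := by exact_mod_cast Real.pi_ne_zero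
  have hfour : ∀ (n : ℤ) (x : ℝ), fourier n (x : AddCircle (2 * Real.pi))
      = Complex.exp (Complex.I * n * x) := fun n x => by
    rw [fourier_coe_apply]
    congr 1
    push_cast
    field_simp
  have hc : ∀ m, fourierCoeff F m = coeff φ m := fun m => by
    rw [fourierCoeff_eq_intervalIntegral _ m 0, coeff, zero_add, Complex.real_smul]
    push_cast
    congr 1
    refine intervalIntegral.integral_congr fun x _ => ?_
    simp only [hfour, smul_eq_mul]
    push_cast
    rfl
  have hs : Summable (fourierCoeff F) := by
    rw [funext hc]
    exact φ.summable_norm_coeff.of_norm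
  have h := has_pointwise_sum_fourier_series_of_summable hs (θ : AddCircle (2 * Real.pi))
  simp_rw [hc, hfour, smul_eq_mul] at h
  exact h

/-- The value at a point, as a linear map. -/
def evalLinear (θ : ℝ) : CircleTest →ₗ[ℂ] ℂ where
  toFun φ := φ θ
  map_add' _ _ := rfl
  map_smul' _ _ := rfl

/-- For each `j`, the `j`-th derivative of the remainder is, at every angle, bounded by the tail of
the absolutely convergent series of coefficients of `φ^(j)`. This tail does not depend on the angle,
so every seminorm of the remainder tends to zero. -/
theorem hasSum_coeff_smul_mode (φ : CircleTest) :
    HasSum (fun m : ℤ => coeff φ m • mode m) φ := by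
  refine (withSeminorms.tendsto_nhds _ φ).2 fun j ε hε => ?_
  have hlim := tendsto_tsum_compl_atTop_zero fun m : ℤ => ‖coeff ((derivative ^ j) φ) m‖
  filter_upwards [hlim.eventually_lt_const hε] with s hs
  refine lt_of_le_of_lt ?_ hs
  rw [seminormFamily_apply]
  refine ciSup_le fun θ => ?_
  have hsum := ((derivative ^ j) φ).hasSum_coeff_mul_exp θ
  have hnorm : ∀ m : ℤ, ‖coeff ((derivative ^ j) φ) m * Complex.exp (Complex.I * m * θ)‖
      = ‖coeff ((derivative ^ j) φ) m‖ := fun m => by rw [norm_mul, norm_exp_mode, mul_one]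
  have hval : (derivative ^ j) (∑ m ∈ s, coeff φ m • mode m - φ) θ
      = ∑ m ∈ s, coeff ((derivative ^ j) φ) m * Complex.exp (Complex.I * m * θ)
        - (derivative ^ j) φ θ := by
    change evalLinear θ _ = _ - evalLinear θ _
    rw [map_sub, map_sub, map_sum, map_sum]
    congr 1
    refine Finset.sum_congr rfl fun m _ => ?_
    rw [map_smul, derivative_pow_mode, map_smul, map_smul, coeff_derivative_pow, smul_eq_mul,
      smul_eq_mul]
    change _ * (_ * Complex.exp _) = _
    ring
  rw [hval, ← hsum.tsum_eq, ← hsum.summable.sum_add_tsum_compl (s := s), sub_add_cancel_left,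
    norm_neg]
  refine (norm_tsum_le_tsum_norm ?_).trans (le_of_eq ?_)
  · exact (hsum.summable.norm.subtype _)
  · exact tsum_congr fun m => hnorm m

end CircleTest

/-! ### Fourier coefficients of distributions: pairing and growth. -/

namespace CircleDistribution

open CircleTest

theorem apply_mode (f : CircleDistribution) (m : ℤ) :
    f (mode m) = 2 * Real.pi * f.fourierCoeff (-m) := by
  have hpi : (Real.pi : ℂ) ≠ 0 := by exact_mod_cast Real.pi_ne_zero
  rw [fourierCoeff, neg_neg]
  field_simp

theorem hasSum_coeff_mul (f : CircleDistribution) (φ : CircleTest) :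
    HasSum (fun m : ℤ => 2 * Real.pi * f.fourierCoeff m * coeff φ (-m)) (f φ) := by
  have h := f.hasSum φ.hasSum_coeff_smul_mode
  -- The pairing is bilinear, so `f` of the mode `m` carries the coefficient of index `-m`.
  rw [← (Equiv.neg ℤ).hasSum_iff] at h
  refine h.congr_fun fun m => ?_
  simp only [Function.comp_apply, Equiv.neg_apply, map_smul, smul_eq_mul, apply_mode, neg_neg]
  ring

/-- The Fourier coefficients of a distribution grow at most polynomially. -/
theorem exists_norm_fourierCoeff_le (f : CircleDistribution) :
    ∃ (C : ℝ) (N : ℕ), 0 ≤ C ∧ ∀ m : ℤ, ‖f.fourierCoeff m‖ ≤ C * (1 + |(m : ℝ)|) ^ N := by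
  -- Continuity bounds `f` by finitely many seminorms, and the `j`-th seminorm of a mode is `|m|^j`;
  -- the exponent is the largest order that occurs.
  obtain ⟨s, C, -, hC⟩ := Seminorm.bound_of_continuous withSeminorms
    ((normSeminorm ℂ ℂ).comp (f : CircleTest →ₗ[ℂ] ℂ)) (continuous_norm.comp f.continuous)
  refine ⟨‖(1 / (2 * Real.pi) : ℂ)‖ * C, s.sup id, by positivity, fun m => ?_⟩
  rw [fourierCoeff, norm_mul, mul_assoc]
  refine mul_le_mul_of_nonneg_left ((hC (mode (-m))).trans ?_) (norm_nonneg _)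
  refine mul_le_mul_of_nonneg_left ?_ C.2
  refine Seminorm.finset_sup_apply_le (by positivity) fun j hj => ?_
  rw [seminormFamily_apply]
  refine ciSup_le fun θ => ?_
  rw [derivative_pow_mode]
  change ‖_ * Complex.exp _‖ ≤ _
  rw [norm_mul, norm_exp_mode, mul_one, norm_pow, norm_mul, Complex.norm_I, one_mul,
    Complex.norm_intCast, Int.cast_neg, abs_neg]
  have h0 := abs_nonneg (m : ℝ)
  calc |(m : ℝ)| ^ j ≤ (1 + |(m : ℝ)|) ^ j := by gcongr; linarith
    _ ≤ _ := pow_le_pow_right₀ (by linarith) (Finset.le_sup (f := id) hj)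

end CircleDistribution

/-! ### Angular Fourier coefficients of functions on the plane -/

/-- `∫_{-π}^{π} e^{imθ} ψ(r e^{iθ}) dθ`. -/
def angularCoeff (ψ : ℂ → ℂ) (m : ℤ) (r : ℝ) : ℂ :=
  ∫ θ in (-Real.pi)..Real.pi, Complex.exp (Complex.I * m * θ) * ψ (circleMap 0 r θ)

theorem continuous_circleMap_uncurry : Continuous fun p : ℝ × ℝ => circleMap 0 p.1 p.2 := by
  unfold circleMap
  fun_prop

theorem continuous_angularCoeff {ψ : ℂ → ℂ} (hψ : Continuous ψ) (m : ℤ) :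
    Continuous (angularCoeff ψ m) := by
  have h := hψ.comp continuous_circleMap_uncurry
  refine intervalIntegral.continuous_parametric_intervalIntegral_of_continuous' ?_ _ _
  exact (by fun_prop : Continuous fun p : ℝ × ℝ => Complex.exp (Complex.I * m * p.2)).mul h

/-- Differentiation under the integral sign for jointly continuous derivatives. -/
theorem hasDerivAt_intervalIntegral_of_continuous {F F' : ℝ → ℝ → ℂ} (hF : Continuous F.uncurry)
    (hF' : Continuous F'.uncurry) (hd : ∀ r θ, HasDerivAt (fun r => F r θ) (F' r θ) r)
    (a b r : ℝ) :
    HasDerivAt (fun r => ∫ θ in a..b, F r θ) (∫ θ in a..b, F' r θ) r := by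
  obtain ⟨C, hC⟩ := ((isCompact_closedBall r 1).prod (isCompact_uIcc (a := a) (b := b))).exists_bound_of_continuousOn
    hF'.continuousOn
  refine (intervalIntegral.hasDerivAt_integral_of_dominated_loc_of_deriv_le (bound := fun _ => C)
    (Metric.closedBall_mem_nhds r one_pos) (Eventually.of_forall fun x => ?_) ?_ ?_ ?_ ?_ ?_).2
  · exact (hF.uncurry_left x).aestronglyMeasurable
  · exact (hF.uncurry_left r).intervalIntegrable _ _
  · exact (hF'.uncurry_left r).aestronglyMeasurable
  · exact Eventually.of_forall fun θ hθ x hx => hC (x, θ) ⟨hx, uIoc_subset_uIcc hθ⟩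
  · exact intervalIntegrable_const
  · exact Eventually.of_forall fun θ _ x _ => hd x θ

theorem hasDerivAt_circleMap_radius (r θ : ℝ) :
    HasDerivAt (fun r => circleMap 0 r θ) (circleMap 0 1 θ) r := by
  have h := ((Complex.ofRealCLM.hasDerivAt (x := r)).mul_const (Complex.exp (θ * Complex.I)))
  simpa [circleMap] using h

/-! ### The Laplacian in polar coordinates and radial Green's formulas. -/

section Smooth

variable {φ : ℂ → ℂ}

/-- The radial derivative of `angularCoeff`, as an integral over the circle. -/
def angularCoeffDeriv (φ : ℂ → ℂ) (m : ℤ) (r : ℝ) : ℂ :=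
  ∫ θ in (-Real.pi)..Real.pi, Complex.exp (Complex.I * m * θ) *
    fderiv ℝ φ (circleMap 0 r θ) (circleMap 0 1 θ)

/-- The second radial derivative of `angularCoeff`, as an integral over the circle. -/
def angularCoeffDeriv₂ (φ : ℂ → ℂ) (m : ℤ) (r : ℝ) : ℂ :=
  ∫ θ in (-Real.pi)..Real.pi, Complex.exp (Complex.I * m * θ) *
    fderiv ℝ (fderiv ℝ φ) (circleMap 0 r θ) (circleMap 0 1 θ) (circleMap 0 1 θ)

theorem continuous_fderiv_circle (hφ : ContDiff ℝ ∞ φ) : Continuous fun p : ℝ × ℝ =>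
    fderiv ℝ φ (circleMap 0 p.1 p.2) (circleMap 0 1 p.2) := by
  have h1 : Continuous (fderiv ℝ φ) := hφ.continuous_fderiv (by simp)
  exact (h1.comp continuous_circleMap_uncurry).clm_apply
    ((continuous_circleMap 0 1).comp continuous_snd)

theorem continuous_fderiv_fderiv_circle (hφ : ContDiff ℝ ∞ φ) : Continuous fun p : ℝ × ℝ =>
    fderiv ℝ (fderiv ℝ φ) (circleMap 0 p.1 p.2) (circleMap 0 1 p.2) (circleMap 0 1 p.2) := by
  have h2 : Continuous (fderiv ℝ (fderiv ℝ φ)) :=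
    (hφ.fderiv_right (m := ∞) (by simp)).continuous_fderiv (by simp)
  exact ((h2.comp continuous_circleMap_uncurry).clm_apply
    ((continuous_circleMap 0 1).comp continuous_snd)).clm_apply
    ((continuous_circleMap 0 1).comp continuous_snd)

theorem continuous_exp_mode_snd (m : ℤ) :
    Continuous fun p : ℝ × ℝ => Complex.exp (Complex.I * m * p.2) := by fun_prop

theorem hasDerivAt_angularCoeff (hφ : ContDiff ℝ ∞ φ) (m : ℤ) (r : ℝ) :
    HasDerivAt (angularCoeff φ m) (angularCoeffDeriv φ m r) r := by
  refine hasDerivAt_intervalIntegral_of_continuous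
    (F := fun r θ => Complex.exp (Complex.I * m * θ) * φ (circleMap 0 r θ))
    (F' := fun r θ => Complex.exp (Complex.I * m * θ) *
      fderiv ℝ φ (circleMap 0 r θ) (circleMap 0 1 θ))
    ((continuous_exp_mode_snd m).mul (hφ.continuous.comp continuous_circleMap_uncurry))
    ((continuous_exp_mode_snd m).mul (continuous_fderiv_circle hφ)) (fun r θ => ?_) _ _ _
  exact (((hφ.differentiable (by simp)) _).hasFDerivAt.comp_hasDerivAt r
    (hasDerivAt_circleMap_radius r θ)).const_mul _

theorem hasDerivAt_angularCoeffDeriv (hφ : ContDiff ℝ ∞ φ) (m : ℤ) (r : ℝ) :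
    HasDerivAt (angularCoeffDeriv φ m) (angularCoeffDeriv₂ φ m r) r := by
  refine hasDerivAt_intervalIntegral_of_continuous
    (F := fun r θ => Complex.exp (Complex.I * m * θ) *
      fderiv ℝ φ (circleMap 0 r θ) (circleMap 0 1 θ))
    (F' := fun r θ => Complex.exp (Complex.I * m * θ) *
      fderiv ℝ (fderiv ℝ φ) (circleMap 0 r θ) (circleMap 0 1 θ) (circleMap 0 1 θ))
    ((continuous_exp_mode_snd m).mul (continuous_fderiv_circle hφ))
    ((continuous_exp_mode_snd m).mul (continuous_fderiv_fderiv_circle hφ)) (fun r θ => ?_) _ _ _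
  have h2 : Differentiable ℝ (fderiv ℝ φ) :=
    (hφ.fderiv_right (m := ∞) (by simp)).differentiable (by simp)
  have h := ((h2 _).hasFDerivAt.comp_hasDerivAt r (hasDerivAt_circleMap_radius r θ)).clm_apply
    (hasDerivAt_const r (circleMap 0 1 θ))
  simpa using h.const_mul (Complex.exp (Complex.I * m * θ))

/-- The trace of a bilinear form is the same in the rotated orthonormal frame `e^(iθ), i e^(iθ)`.
The mixed terms cancel between the two summands, so neither symmetry of the Hessian nor smoothness
is needed. -/
theorem laplacian_apply_eq (φ : ℂ → ℂ) (x : ℂ) (θ : ℝ) :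
    Laplacian.laplacian φ x = fderiv ℝ (fderiv ℝ φ) x (circleMap 0 1 θ) (circleMap 0 1 θ)
      + fderiv ℝ (fderiv ℝ φ) x (circleMap 0 1 θ * Complex.I) (circleMap 0 1 θ * Complex.I) := by
  have e1 : circleMap 0 1 θ = (Real.cos θ) • (1 : ℂ) + (Real.sin θ) • Complex.I := by
    simp [circleMap, Complex.exp_mul_I]
  have e2 : circleMap 0 1 θ * Complex.I = (-Real.sin θ) • (1 : ℂ) + (Real.cos θ) • Complex.I := by
    rw [e1]
    simp only [Complex.real_smul]
    push_cast
    linear_combination (Complex.sin θ) * Complex.I_mul_I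
  rw [InnerProductSpace.laplacian_eq_iteratedFDeriv_complexPlane, e2, e1]
  simp only [iteratedFDeriv_two_apply, map_add, map_smul, _root_.add_apply, _root_.smul_apply,
    Matrix.cons_val_zero, Matrix.cons_val_one]
  simp only [Complex.real_smul]
  push_cast
  linear_combination (-(fderiv ℝ (fderiv ℝ φ) x 1 1) - fderiv ℝ (fderiv ℝ φ) x Complex.I Complex.I)
    * Complex.sin_sq_add_cos_sq θ

theorem continuous_laplacian (hφ : ContDiff ℝ ∞ φ) : Continuous (Laplacian.laplacian φ) := by
  have h2 : Continuous (fderiv ℝ (fderiv ℝ φ)) :=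
    (hφ.fderiv_right (m := ∞) (by simp)).continuous_fderiv (by simp)
  rw [funext fun x => laplacian_apply_eq φ x 0]
  fun_prop

theorem laplacian_eq_zero_of_notMem_tsupport {x : ℂ} (hx : x ∉ tsupport φ) :
    Laplacian.laplacian φ x = 0 := by
  have h := InnerProductSpace.laplacian_congr_nhds (notMem_tsupport_iff_eventuallyEq.1 hx)
  rw [h.eq_of_nhds]
  exact congrFun (InnerProductSpace.laplacian_const (E := ℂ) (c := (0 : ℂ))) x

/-- Angular integration by parts: the polar form of the Laplacian on an angular mode. -/
theorem sq_mul_angularCoeff_laplacian (hφ : ContDiff ℝ ∞ φ) (m : ℤ) (r : ℝ) :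
    (r : ℂ) ^ 2 * angularCoeff (Laplacian.laplacian φ) m r
      = (r : ℂ) ^ 2 * angularCoeffDeriv₂ φ m r + r * angularCoeffDeriv φ m r
        - (m : ℂ) ^ 2 * angularCoeff φ m r := by
  have hd1 : Differentiable ℝ φ := hφ.differentiable (by simp)
  have hd2 : Differentiable ℝ (fderiv ℝ φ) :=
    (hφ.fderiv_right (m := ∞) (by simp)).differentiable (by simp)
  set E : ℝ → ℂ := fun θ => Complex.exp (Complex.I * m * θ) with hE
  set A : ℝ → ℂ := fun θ => φ (circleMap 0 r θ) with hA
  set B₁ : ℝ → ℂ := fun θ => fderiv ℝ φ (circleMap 0 r θ) (circleMap 0 r θ * Complex.I) with hB₁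
  set B₂ : ℝ → ℂ := fun θ => fderiv ℝ (fderiv ℝ φ) (circleMap 0 r θ) (circleMap 0 r θ * Complex.I)
      (circleMap 0 r θ * Complex.I)
    + fderiv ℝ φ (circleMap 0 r θ) (circleMap 0 r θ * Complex.I * Complex.I) with hB₂
  have hEd : ∀ θ, HasDerivAt E (Complex.I * m * E θ) θ := CircleTest.hasDerivAt_exp_mode m
  have hAd : ∀ θ, HasDerivAt A (B₁ θ) θ := fun θ =>
    (hd1 _).hasFDerivAt.comp_hasDerivAt θ (hasDerivAt_circleMap 0 r θ)
  have hBd : ∀ θ, HasDerivAt B₁ (B₂ θ) θ := fun θ =>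
    ((hd2 _).hasFDerivAt.comp_hasDerivAt θ (hasDerivAt_circleMap 0 r θ)).clm_apply
      ((hasDerivAt_circleMap 0 r θ).mul_const Complex.I)
  have hc := continuous_circleMap 0 r
  have hc1 := continuous_circleMap 0 1
  have hcd1 : Continuous (fderiv ℝ φ) := hd2.continuous
  have hcd2 : Continuous (fderiv ℝ (fderiv ℝ φ)) :=
    (hφ.fderiv_right (m := ∞) (by simp)).continuous_fderiv (by simp)
  have hEc : Continuous E := by fun_prop
  have hAc : Continuous A := hφ.continuous.comp hc
  have hBc : Continuous B₂ := by fun_prop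
  have hzero : ∫ θ in (-Real.pi)..Real.pi, (E θ * B₂ θ + (m : ℂ) ^ 2 * (E θ * A θ)) = 0 := by
    -- Two angular integrations by parts at once: the integrand has a periodic primitive, so it
    -- integrates to zero over a full turn.
    have hG : ∀ θ, HasDerivAt (fun θ => E θ * B₁ θ - Complex.I * m * (E θ * A θ))
        (E θ * B₂ θ + (m : ℂ) ^ 2 * (E θ * A θ)) θ := fun θ => by
      convert! ((hEd θ).mul (hBd θ)).sub (((hEd θ).mul (hAd θ)).const_mul (Complex.I * m)) using 1
      linear_combination ((m : ℂ) ^ 2 * (E θ * A θ)) * Complex.I_sq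
    rw [intervalIntegral.integral_eq_sub_of_hasDerivAt (fun θ _ => hG θ)
      (Continuous.intervalIntegrable (by fun_prop) _ _)]
    have hp : circleMap 0 r Real.pi = circleMap 0 r (-Real.pi) := by
      have := periodic_circleMap 0 r (-Real.pi)
      rwa [show -Real.pi + 2 * Real.pi = Real.pi by ring] at this
    have hpE : E Real.pi = E (-Real.pi) := by
      have := (CircleTest.mode m).periodic (-Real.pi)
      rwa [show -Real.pi + 2 * Real.pi = Real.pi by ring] at this
    simp only [hA, hB₁, hp, hpE, sub_self]
  have hpt : ∀ θ, (r : ℂ) ^ 2 * (E θ * Laplacian.laplacian φ (circleMap 0 r θ))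
      = (r : ℂ) ^ 2 * (E θ * fderiv ℝ (fderiv ℝ φ) (circleMap 0 r θ) (circleMap 0 1 θ)
          (circleMap 0 1 θ))
        + r * (E θ * fderiv ℝ φ (circleMap 0 r θ) (circleMap 0 1 θ)) + E θ * B₂ θ := fun θ => by
    -- `B₂` is `r²` times the tangential second derivative minus `r` times the radial first
    -- derivative; the latter produces the first-order term of the polar Laplacian.
    have hr : circleMap 0 r θ * Complex.I = r • (circleMap 0 1 θ * Complex.I) := by
      simp [circleMap, mul_assoc]
    have hr' : circleMap 0 r θ * Complex.I * Complex.I = -(r • circleMap 0 1 θ) := by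
      rw [mul_assoc, Complex.I_mul_I]
      simp [circleMap]
    simp only [hB₂]
    rw [laplacian_apply_eq φ _ θ, hr', hr]
    simp only [map_smul, map_neg, _root_.smul_apply]
    simp only [Complex.real_smul]
    ring
  have hi1 : IntervalIntegrable (fun θ => (r : ℂ) ^ 2 * (E θ * fderiv ℝ (fderiv ℝ φ)
      (circleMap 0 r θ) (circleMap 0 1 θ) (circleMap 0 1 θ))) volume (-Real.pi) Real.pi :=
    Continuous.intervalIntegrable (by fun_prop) _ _
  have hi2 : IntervalIntegrable (fun θ => (r : ℂ) * (E θ * fderiv ℝ φ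
      (circleMap 0 r θ) (circleMap 0 1 θ))) volume (-Real.pi) Real.pi :=
    Continuous.intervalIntegrable (by fun_prop) _ _
  rw [intervalIntegral.integral_add (Continuous.intervalIntegrable (by fun_prop) _ _)
    (Continuous.intervalIntegrable (by fun_prop) _ _), intervalIntegral.integral_const_mul] at hzero
  have hL : (r : ℂ) ^ 2 * angularCoeff (Laplacian.laplacian φ) m r
      = (r : ℂ) ^ 2 * angularCoeffDeriv₂ φ m r + r * angularCoeffDeriv φ m r
        + ∫ θ in (-Real.pi)..Real.pi, E θ * B₂ θ := by
    rw [angularCoeff, angularCoeffDeriv, angularCoeffDeriv₂]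
    simp only [← intervalIntegral.integral_const_mul]
    rw [intervalIntegral.integral_congr fun θ _ => hpt θ,
      intervalIntegral.integral_add (hi1.add hi2)
        (Continuous.intervalIntegrable (by fun_prop) _ _), intervalIntegral.integral_add hi1 hi2]
  have hAm : angularCoeff φ m r = ∫ θ in (-Real.pi)..Real.pi, E θ * A θ := rfl
  rw [hL, hAm]
  linear_combination hzero

theorem angularCoeff_eq_zero {ψ : ℂ → ℂ} (h : ∀ x, 1 ≤ ‖x‖ → ψ x = 0) (m : ℤ) {r : ℝ}
    (hr : 1 ≤ r) : angularCoeff ψ m r = 0 := by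
  unfold angularCoeff
  have : ∀ θ, ψ (circleMap 0 r θ) = 0 := fun θ => h _ (by
    simpa [abs_of_nonneg (zero_le_one.trans hr)] using hr)
  simp [this]

theorem angularCoeffDeriv_one_eq_zero (hs : tsupport φ ⊆ Metric.ball (0 : ℂ) 1) (m : ℤ) :
    angularCoeffDeriv φ m 1 = 0 := by
  unfold angularCoeffDeriv
  have : ∀ θ, fderiv ℝ φ (circleMap 0 1 θ) = 0 := fun θ => by
    apply image_eq_zero_of_notMem_tsupport
    intro h
    have := hs (tsupport_fderiv_subset ℝ h)
    simp at this
  simp [this]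

/-- Green's formula for the radial part of the Laplacian, against a solution `P` of the Euler
equation `r (r P')' = m² P`, with `R = r P'`. -/
theorem integral_mul_angularCoeff_laplacian (hφ : ContDiff ℝ ∞ φ)
    (hs : tsupport φ ⊆ Metric.ball (0 : ℂ) 1) (m : ℤ) {P R : ℝ → ℝ} {a : ℝ} (ha0 : 0 ≤ a)
    (ha1 : a ≤ 1) (hP : ContinuousOn P (Icc a 1)) (hR : ContinuousOn R (Icc a 1))
    (hPd : ∀ r ∈ Ioo a 1, HasDerivAt P (R r / r) r)
    (hRd : ∀ r ∈ Ioo a 1, HasDerivAt R ((m : ℝ) ^ 2 * P r / r) r) :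
    ∫ r in a..1, (P r : ℂ) * r * angularCoeff (Laplacian.laplacian φ) m r
      = R a * angularCoeff φ m a - P a * a * angularCoeffDeriv φ m a := by
  have hc0 : Continuous (angularCoeff φ m) := continuous_angularCoeff hφ.continuous m
  have hc1 : Continuous (angularCoeffDeriv φ m) := continuous_iff_continuousAt.2 fun r =>
    (hasDerivAt_angularCoeffDeriv hφ m r).continuousAt
  have hcL := continuous_angularCoeff (continuous_laplacian hφ) m
  have hP' : ContinuousOn (fun r => (P r : ℂ)) (Icc a 1) :=
    Complex.continuous_ofReal.comp_continuousOn hP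
  have hR' : ContinuousOn (fun r => (R r : ℂ)) (Icc a 1) :=
    Complex.continuous_ofReal.comp_continuousOn hR
  have hcr : Continuous fun r : ℝ => (r : ℂ) := Complex.continuous_ofReal
  have hint : IntervalIntegrable (fun r => (P r : ℂ) * r * angularCoeff (Laplacian.laplacian φ) m r)
      volume a 1 := by
    apply ContinuousOn.intervalIntegrable
    rw [uIcc_of_le ha1]
    exact (hP'.mul hcr.continuousOn).mul hcL.continuousOn
  -- The primitive is the Wronskian-type expression `r (P ψ' - P' ψ)`, with `ψ` the angular
  -- coefficient; its value at `1` vanishes by the support condition.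
  rw [intervalIntegral.integral_eq_sub_of_hasDerivAt_of_le ha1
    (f := fun r => (P r : ℂ) * r * angularCoeffDeriv φ m r - R r * angularCoeff φ m r) ?_ ?_ hint]
  · have h1 : angularCoeff φ m 1 = 0 := angularCoeff_eq_zero (fun x hx =>
      image_eq_zero_of_notMem_tsupport fun h => by
        have := hs h
        rw [mem_ball_zero_iff] at this
        linarith) m le_rfl
    simp only [h1, angularCoeffDeriv_one_eq_zero hs m]
    ring
  · exact ((hP'.mul hcr.continuousOn).mul hc1.continuousOn).sub (hR'.mul hc0.continuousOn)
  · intro r hr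
    have hr0 : (r : ℂ) ≠ 0 := by exact_mod_cast (ha0.trans_lt hr.1).ne'
    convert! (((hPd r hr).ofReal_comp.fun_mul (Complex.ofRealCLM.hasDerivAt (x := r))).fun_mul
      (hasDerivAt_angularCoeffDeriv hφ m r)).sub
      ((hRd r hr).ofReal_comp.mul (hasDerivAt_angularCoeff hφ m r)) using 1
    have h := sq_mul_angularCoeff_laplacian hφ m r
    apply mul_left_cancel₀ hr0
    simp only [Complex.ofRealCLM_apply]
    push_cast
    field_simp
    linear_combination (P r : ℂ) * h

/-- Green's formula from `0` with `P = r^|m|` and `R = |m| r^|m|`. At the origin `R` vanishes in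
every case, through the factor `|m|` when `m = 0`. -/
theorem integral_pow_mul_angularCoeff_laplacian (hφ : ContDiff ℝ ∞ φ)
    (hs : tsupport φ ⊆ Metric.ball (0 : ℂ) 1) (m : ℤ) :
    ∫ r in (0 : ℝ)..1, (r : ℂ) ^ (m.natAbs + 1) * angularCoeff (Laplacian.laplacian φ) m r = 0 := by
  have hm : ((m.natAbs : ℝ)) ^ 2 = (m : ℝ) ^ 2 := by
    rw [Nat.cast_natAbs, Int.cast_abs, sq_abs]
  have hd : ∀ r ∈ Ioo (0 : ℝ) 1,
      HasDerivAt (fun r : ℝ => r ^ m.natAbs) ((m.natAbs : ℝ) * r ^ m.natAbs / r) r := fun r hr => by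
    convert! hasDerivAt_pow m.natAbs r using 1
    rcases Nat.eq_zero_or_pos m.natAbs with h | h
    · simp [h]
    · obtain ⟨k, hk⟩ := Nat.exists_eq_add_of_lt h
      rw [zero_add] at hk
      rw [hk, Nat.add_sub_cancel, pow_succ]
      have := hr.1.ne'
      field_simp
  have h := integral_mul_angularCoeff_laplacian hφ hs m (P := fun r => r ^ m.natAbs)
    (R := fun r => m.natAbs * r ^ m.natAbs) le_rfl zero_le_one (by fun_prop) (by fun_prop) hd
    (fun r hr => by
      convert! (hd r hr).const_mul (m.natAbs : ℝ) using 1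
      rw [← hm]
      ring)
  refine Eq.trans ?_ (h.trans ?_)
  · refine intervalIntegral.integral_congr fun r _ => ?_
    push_cast
    ring
  · rcases Nat.eq_zero_or_pos m.natAbs with h | h
    · simp [h]
    · simp [h.ne']

/-- As a function of `r`, `r^|m| besselRatio |m| (s/r)` solves the Euler equation, vanishes at `r =
s`, and has `r P' = s^|m|` there, so Green's formula leaves only the value of the angular
coefficient at `s`. Explicitly `P = log r - log s` for `m = 0`, and `P = (r^n - s^(2n) r^(-n)) /
(2n)` for `n = |m| ≥ 1`. -/
theorem integral_besselRatio_mul_angularCoeff_laplacian (hφ : ContDiff ℝ ∞ φ)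
    (hs : tsupport φ ⊆ Metric.ball (0 : ℂ) 1) (m : ℤ) {s : ℝ} (hs0 : 0 < s) (hs1 : s ≤ 1) :
    ∫ r in s..1, ((r ^ m.natAbs * besselRatio m.natAbs (s / r) : ℝ) : ℂ) * r
        * angularCoeff (Laplacian.laplacian φ) m r
      = (s : ℂ) ^ m.natAbs * angularCoeff φ m s := by
  have hm : ((m.natAbs : ℝ)) ^ 2 = (m : ℝ) ^ 2 := by
    rw [Nat.cast_natAbs, Int.cast_abs, sq_abs]
  set n := m.natAbs with hn
  have hne : ∀ r ∈ Icc s 1, r ≠ 0 := fun r hr => (hs0.trans_le hr.1).ne'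
  have hPc : ContinuousOn (fun r : ℝ => r ^ n * besselRatio n (s / r)) (Icc s 1) :=
    (continuousOn_pow n).mul ((continuousOn_besselRatio n).comp
      (continuousOn_const.div continuousOn_id hne)
      fun r hr => div_pos hs0 (hs0.trans_le hr.1))
  have hPs : s ^ n * besselRatio n (s / s) = 0 := by
    rw [div_self hs0.ne', besselRatio_one, mul_zero]
  rcases Nat.eq_zero_or_pos n with h0 | h0
  · have h := integral_mul_angularCoeff_laplacian hφ hs m
      (P := fun r => r ^ n * besselRatio n (s / r)) (R := fun _ => 1) hs0.le hs1 hPc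
      continuousOn_const (fun r hr => ?_) (fun r hr => ?_)
    · rw [h, hPs, h0]
      simp
    · have hr0 := hne r (Ioo_subset_Icc_self hr)
      have e : (fun r : ℝ => r ^ n * besselRatio n (s / r)) =ᶠ[𝓝 r]
          fun r => Real.log r - Real.log s := by
        filter_upwards [isOpen_ne.mem_nhds hr0] with x hx
        rw [h0, besselRatio, if_pos rfl, Real.log_div hs0.ne' hx]
        ring
      refine HasDerivAt.congr_of_eventuallyEq ?_ e
      rw [one_div]
      exact (Real.hasDerivAt_log hr0).sub_const _
    · have : (m : ℝ) = 0 := by exact_mod_cast Int.natAbs_eq_zero.1 h0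
      simpa [this] using hasDerivAt_const r (1 : ℝ)
  · have hn0 : (n : ℝ) ≠ 0 := by exact_mod_cast h0.ne'
    have hd : ∀ r : ℝ, r ≠ 0 → HasDerivAt (fun r : ℝ => r ^ n) ((n : ℝ) * r ^ n / r) r :=
      fun r hr => by
        convert! hasDerivAt_pow n r using 1
        obtain ⟨k, hk⟩ := Nat.exists_eq_add_of_lt h0
        rw [zero_add] at hk
        rw [hk, Nat.add_sub_cancel, pow_succ]
        field_simp
    have hdi : ∀ r : ℝ, r ≠ 0 →
        HasDerivAt (fun r : ℝ => (r ^ n)⁻¹) (-((n : ℝ) * (r ^ n)⁻¹ / r)) r := fun r hr => by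
      convert! (hd r hr).fun_inv (pow_ne_zero n hr) using 1
      have := pow_ne_zero n hr
      field_simp
    have h := integral_mul_angularCoeff_laplacian hφ hs m
      (P := fun r => r ^ n * besselRatio n (s / r))
      (R := fun r => (r ^ n + s ^ (2 * n) * (r ^ n)⁻¹) / 2) hs0.le hs1 hPc
      ?_ (fun r hr => ?_) (fun r hr => ?_)
    · rw [h, hPs]
      have : s ^ (2 * n) * (s ^ n)⁻¹ = s ^ n := by
        have := pow_ne_zero n hs0.ne'
        rw [two_mul, pow_add]
        field_simp
      rw [this]
      push_cast
      ring
    · refine ContinuousOn.div_const ((continuousOn_pow n).add (continuousOn_const.mul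
        ((continuousOn_pow n).inv₀ fun r hr => pow_ne_zero n (hne r hr)))) _
    · have hr0 := hne r (Ioo_subset_Icc_self hr)
      have e : (fun r : ℝ => r ^ n * besselRatio n (s / r)) =ᶠ[𝓝 r]
          fun r => (r ^ n - s ^ (2 * n) * (r ^ n)⁻¹) / (2 * n) := by
        filter_upwards [isOpen_ne.mem_nhds hr0] with x hx
        have := pow_ne_zero n hx
        rw [besselRatio, if_neg h0.ne', div_pow, two_mul, pow_add, pow_add]
        field_simp
      refine HasDerivAt.congr_of_eventuallyEq ?_ e
      convert! ((hd r hr0).sub ((hdi r hr0).const_mul (s ^ (2 * n)))).div_const (2 * (n : ℝ)) using 1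
      field_simp
      ring
    · have hr0 := hne r (Ioo_subset_Icc_self hr)
      convert! ((hd r hr0).add ((hdi r hr0).const_mul (s ^ (2 * n)))).div_const 2 using 1
      have := pow_ne_zero n hr0
      rw [← hm, besselRatio, if_neg h0.ne', div_pow, two_mul, pow_add, pow_add]
      field_simp
      ring

end Smooth

/-! ### Each angular mode is a distributional solution -/

section Modes

variable {V : ℝ → ℂ} {φ : ℂ → ℂ}

theorem integral_mul_volterraKernel (hφ : ContDiff ℝ ∞ φ)
    (hs : tsupport φ ⊆ Metric.ball (0 : ℂ) 1) (m : ℤ) {s : ℝ} (hs' : s ∈ Ioo (0 : ℝ) 1) :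
    ∫ r in Ioo (0 : ℝ) 1, (r : ℂ) ^ (m.natAbs + 1) * angularCoeff (Laplacian.laplacian φ) m r
        * volterraKernel m.natAbs r s
      = (s : ℂ) ^ (m.natAbs + 1) * angularCoeff φ m s := by
  have h := integral_besselRatio_mul_angularCoeff_laplacian hφ hs m hs'.1 hs'.2.le
  rw [intervalIntegral.integral_of_le hs'.2.le, integral_Ioc_eq_integral_Ioo] at h
  rw [pow_succ', mul_assoc, ← h, ← integral_const_mul]
  rw [setIntegral_eq_of_subset_of_forall_sdiff_eq_zero measurableSet_Ioo
    (Ioo_subset_Ioo_left hs'.1.le)]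
  · refine setIntegral_congr_fun measurableSet_Ioo fun r hr => ?_
    have hr0 : 0 < r := hs'.1.trans hr.1
    simp only [volterraKernel]
    rw [min_eq_left ((div_le_one hr0).2 hr.1.le)]
    push_cast
    ring
  · intro r hr
    have : r ≤ s := by
      by_contra! hc
      exact hr.2 ⟨hc, hr.1.2⟩
    rw [volterraKernel_eq_zero _ hr.1.1 this]
    simp

/-- The radial weak form of the equation for `r^{|m|} α_{|m|}(r)`. -/
theorem integral_radialAlpha_mul_angularCoeff
    (hV : IntegrableOn (fun r : ℝ => ((r * (1 - Real.log r) : ℝ) : ℂ) * V r) (Ioo 0 1) volume)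
    (hφ : ContDiff ℝ ∞ φ) (hs : tsupport φ ⊆ Metric.ball (0 : ℂ) 1) (m : ℤ) :
    ∫ r in Ioo (0 : ℝ) 1, (r : ℂ) ^ (m.natAbs + 1) * radialAlpha V m.natAbs r
        * angularCoeff (Laplacian.laplacian φ) m r
      = ∫ r in Ioo (0 : ℝ) 1, (r : ℂ) ^ (m.natAbs + 1) * V r * radialAlpha V m.natAbs r
        * angularCoeff φ m r := by
  set n := m.natAbs with hn
  set q : ℝ → ℂ := fun r => (r : ℂ) ^ (n + 1) * angularCoeff (Laplacian.laplacian φ) m r with hq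
  have hqc : Continuous q := (Complex.continuous_ofReal.pow _).mul
    (continuous_angularCoeff (continuous_laplacian hφ) m)
  obtain ⟨C, hC⟩ := (isCompact_Icc (a := (0 : ℝ)) (b := 1)).exists_bound_of_continuousOn
    hqc.continuousOn
  have hC0 : 0 ≤ C := (norm_nonneg _).trans (hC 0 ⟨le_rfl, zero_le_one⟩)
  set M := Real.exp (logMass V 1) with hM
  have hαc : ContinuousOn (radialAlpha V n) (Ioo 0 1) :=
    (continuousOn_radialAlpha hV n).mono Ioo_subset_Ioc_self
  set μ := (volume : Measure ℝ).restrict (Ioo 0 1) with hμ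
  have hμμ : μ.prod μ = (volume : Measure (ℝ × ℝ)).restrict (Ioo 0 1 ×ˢ Ioo 0 1) := by
    rw [hμ, Measure.prod_restrict]; rfl
  have hmeas : AEStronglyMeasurable (fun p : ℝ × ℝ =>
      q p.1 * ((volterraKernel n p.1 p.2 : ℂ) * V p.2 * radialAlpha V n p.2)) (μ.prod μ) := by
    have h1 : AEStronglyMeasurable (fun p : ℝ × ℝ => (volterraKernel n p.1 p.2 : ℂ))
        (μ.prod μ) := by
      rw [hμμ]
      refine ContinuousOn.aestronglyMeasurable ?_ (measurableSet_Ioo.prod measurableSet_Ioo)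
      exact Complex.continuous_ofReal.comp_continuousOn ((continuousOn_volterraKernel n).mono
        (prod_mono (fun x hx => hx.1) (fun x hx => hx.1)))
    have h2 : AEStronglyMeasurable (fun p : ℝ × ℝ => V p.2) (μ.prod μ) :=
      (aestronglyMeasurable_potential hV).comp_snd
    have h3 : AEStronglyMeasurable (fun p : ℝ × ℝ => radialAlpha V n p.2) (μ.prod μ) :=
      AEStronglyMeasurable.comp_snd (hαc.aestronglyMeasurable measurableSet_Ioo)
    exact (hqc.comp continuous_fst).aestronglyMeasurable.mul ((h1.mul h2).mul h3)
  have hbound : ∀ r ∈ Ioo (0 : ℝ) 1, ∀ s ∈ Ioo (0 : ℝ) 1,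
      ‖q r * ((volterraKernel n r s : ℂ) * V s * radialAlpha V n s)‖ ≤ C * (logWeight V s * M) := by
    intro r hr s hs
    rw [norm_mul, norm_mul _ (radialAlpha V n s)]
    refine mul_le_mul (hC r (Ioo_subset_Icc_self hr)) ?_ (by positivity) hC0
    exact mul_le_mul (norm_volterraKernel_mul_le V n (Ioo_subset_Ioc_self hr) hs)
      (norm_radialAlpha_le hV n (Ioo_subset_Icc_self hs)) (norm_nonneg _) (logWeight_nonneg V hs)
  have hint : Integrable (fun p : ℝ × ℝ =>
      q p.1 * ((volterraKernel n p.1 p.2 : ℂ) * V p.2 * radialAlpha V n p.2)) (μ.prod μ) := by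
    have hw : Integrable (fun p : ℝ × ℝ => C * (logWeight V p.2 * M)) (μ.prod μ) :=
      (integrable_const C).mul_prod ((integrableOn_logWeight hV).mul_const M)
    refine hw.mono' hmeas ?_
    rw [hμμ]
    exact (ae_restrict_mem (measurableSet_Ioo.prod measurableSet_Ioo)).mono
      fun p hp => hbound p.1 hp.1 p.2 hp.2
  have hq0 : ∫ r in Ioo (0 : ℝ) 1, q r = 0 := by
    have := integral_pow_mul_angularCoeff_laplacian hφ hs m
    rwa [intervalIntegral.integral_of_le zero_le_one, integral_Ioc_eq_integral_Ioo] at this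
  have hqi : IntegrableOn q (Ioo 0 1) :=
    (hqc.continuousOn.integrableOn_compact isCompact_Icc).mono_set Ioo_subset_Icc_self
  calc ∫ r in Ioo (0 : ℝ) 1, (r : ℂ) ^ (n + 1) * radialAlpha V n r
        * angularCoeff (Laplacian.laplacian φ) m r
      = ∫ r in Ioo (0 : ℝ) 1, (q r + ∫ s in Ioo (0 : ℝ) 1,
          q r * ((volterraKernel n r s : ℂ) * V s * radialAlpha V n s)) := by
        refine setIntegral_congr_fun measurableSet_Ioo fun r hr => ?_
        rw [radialAlpha_eq_one_add hV n (Ioo_subset_Ioc_self hr), integral_const_mul]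
        simp only [hq, volterraOp]
        ring
    _ = ∫ r in Ioo (0 : ℝ) 1, ∫ s in Ioo (0 : ℝ) 1,
          q r * ((volterraKernel n r s : ℂ) * V s * radialAlpha V n s) := by
        rw [integral_add hqi hint.integral_prod_left, hq0, zero_add]
    _ = ∫ s in Ioo (0 : ℝ) 1, ∫ r in Ioo (0 : ℝ) 1,
          q r * ((volterraKernel n r s : ℂ) * V s * radialAlpha V n s) :=
        integral_integral_swap hint
    _ = _ := by
        refine setIntegral_congr_fun measurableSet_Ioo fun s hs' => ?_
        have h := integral_mul_volterraKernel hφ hs m hs'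
        simp only [← mul_assoc]
        rw [integral_mul_const, integral_mul_const]
        rw [h]
        ring

/-- Polar coordinates for a radial function times an angular mode times a test function. -/
theorem setIntegral_ball_radial_mul_mode {R : ℝ → ℂ} {ψ : ℂ → ℂ}
    (hR : IntegrableOn (fun r : ℝ => (r : ℂ) * R r) (Ioo 0 1) volume) (hψ : Continuous ψ)
    (hψc : HasCompactSupport ψ) (hψ0 : ∀ x, 1 ≤ ‖x‖ → ψ x = 0) (m : ℤ) :
    ∫ x in Metric.ball (0 : ℂ) 1, R ‖x‖ * Complex.exp (Complex.I * m * x.arg) * ψ x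
      = ∫ r in Ioo (0 : ℝ) 1, (r : ℂ) * R r * angularCoeff ψ m r := by
  have hpi : -Real.pi ≤ Real.pi := by linarith [Real.pi_pos]
  have hsymm : ∀ p : ℝ × ℝ, Complex.polarCoord.symm p = circleMap 0 p.1 p.2 := fun p => by
    rw [Complex.polarCoord_symm_apply, circleMap, Complex.exp_mul_I]
    push_cast
    ring
  set G : ℝ × ℝ → ℂ := fun p => ((p.1 : ℂ) * R p.1) *
    (Complex.exp (Complex.I * m * p.2) * ψ (circleMap 0 p.1 p.2)) with hG
  have hprod : IntegrableOn G (Ioo 0 1 ×ˢ Ioo (-Real.pi) Real.pi) volume := by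
    obtain ⟨C, hC⟩ := hψc.exists_bound_of_continuous hψ
    have h1 : Integrable (fun p : ℝ × ℝ => ((p.1 : ℂ) * R p.1) * (1 : ℂ))
        ((volume.restrict (Ioo (0 : ℝ) 1)).prod (volume.restrict (Ioo (-Real.pi) Real.pi))) :=
      Integrable.mul_prod (f := fun r : ℝ => (r : ℂ) * R r) (g := fun _ : ℝ => (1 : ℂ)) hR
        (integrable_const 1)
    rw [Measure.prod_restrict] at h1
    simp only [mul_one] at h1
    refine Integrable.mul_bdd (c := C) h1 ?_ ?_
    · exact ((continuous_exp_mode_snd m).mul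
        (hψ.comp continuous_circleMap_uncurry)).aestronglyMeasurable
    · refine Eventually.of_forall fun p => ?_
      rw [norm_mul, CircleTest.norm_exp_mode, one_mul]
      exact hC _
  have hfull : ∫ x in Metric.ball (0 : ℂ) 1, R ‖x‖ * Complex.exp (Complex.I * m * x.arg) * ψ x
      = ∫ x, R ‖x‖ * Complex.exp (Complex.I * m * x.arg) * ψ x := by
    refine setIntegral_eq_integral_of_forall_compl_eq_zero fun x hx => ?_
    rw [mem_ball_zero_iff, not_lt] at hx
    rw [hψ0 x hx, mul_zero]
  rw [hfull, ← Complex.integral_comp_polarCoord_symm]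
  have hstep : ∫ p in polarCoord.target, p.1 • (R ‖Complex.polarCoord.symm p‖ *
      Complex.exp (Complex.I * m * (Complex.polarCoord.symm p).arg) * ψ (Complex.polarCoord.symm p))
      = ∫ p in Ioi (0 : ℝ) ×ˢ Ioo (-Real.pi) Real.pi, G p := by
    rw [polarCoord_target]
    refine setIntegral_congr_fun (measurableSet_Ioi.prod measurableSet_Ioo) fun p hp => ?_
    have hp1 : 0 < p.1 := hp.1
    have harg : (circleMap 0 p.1 p.2).arg = p.2 := by
      rw [← hsymm, Complex.polarCoord_symm_apply, Complex.ofReal_cos, Complex.ofReal_sin]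
      exact Complex.arg_mul_cos_add_sin_mul_I hp1 (Ioo_subset_Ioc_self hp.2)
    have hnorm : ‖circleMap 0 p.1 p.2‖ = p.1 := by simp [abs_of_pos hp1]
    simp only [hsymm, harg, hnorm, hG, Complex.real_smul]
    ring
  rw [hstep, setIntegral_eq_of_subset_of_forall_sdiff_eq_zero
    (measurableSet_Ioi.prod measurableSet_Ioo) (prod_mono_left Ioo_subset_Ioi_self)]
  · rw [Measure.volume_eq_prod, setIntegral_prod G hprod]
    refine setIntegral_congr_fun measurableSet_Ioo fun r hr => ?_
    simp only [hG]
    rw [integral_const_mul, angularCoeff, intervalIntegral.integral_of_le hpi,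
      integral_Ioc_eq_integral_Ioo]
  · intro p hp
    have hp1 : 0 < p.1 := hp.1.1
    have : 1 ≤ p.1 := by
      by_contra! hc
      exact hp.2 ⟨⟨hp1, hc⟩, hp.1.2⟩
    have : ψ (circleMap 0 p.1 p.2) = 0 := hψ0 _ (by simpa [abs_of_pos hp1] using this)
    simp only [hG, this, mul_zero]

/-- The solution `r^{|m|} α_{|m|}(r) e^{imθ}` on the disk. -/
def diskMode (V : ℝ → ℂ) (m : ℤ) (x : ℂ) : ℂ :=
  (‖x‖ : ℂ) ^ m.natAbs * radialAlpha V m.natAbs ‖x‖ * Complex.exp (Complex.I * m * x.arg)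

theorem norm_diskMode_le
    (hV : IntegrableOn (fun r : ℝ => ((r * (1 - Real.log r) : ℝ) : ℂ) * V r) (Ioo 0 1) volume)
    (m : ℤ) {x : ℂ} (hx : ‖x‖ ≤ 1) :
    ‖diskMode V m x‖ ≤ ‖x‖ ^ m.natAbs * Real.exp (logMass V 1) := by
  rw [diskMode, norm_mul, CircleTest.norm_exp_mode, mul_one, norm_mul, norm_pow, Complex.norm_real,
    norm_norm]
  exact mul_le_mul_of_nonneg_left (norm_radialAlpha_le hV _ ⟨norm_nonneg _, hx⟩) (by positivity)

theorem aestronglyMeasurable_diskMode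
    (hV : IntegrableOn (fun r : ℝ => ((r * (1 - Real.log r) : ℝ) : ℂ) * V r) (Ioo 0 1) volume)
    (m : ℤ) : AEStronglyMeasurable (diskMode V m) (volume.restrict (Metric.ball (0 : ℂ) 1)) := by
  -- Only continuity on `(0,1]` is known. Extending by `1` gives a Borel function that agrees with
  -- `α` at the origin too.
  set a := (Ioc (0 : ℝ) 1).piecewise (radialAlpha V m.natAbs) (fun _ => 1) with ha
  have ham : Measurable a :=
    (continuousOn_radialAlpha hV m.natAbs).measurable_piecewise continuousOn_const
      measurableSet_Ioc
  have h : Measurable fun x : ℂ =>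
      (‖x‖ : ℂ) ^ m.natAbs * a ‖x‖ * Complex.exp (Complex.I * m * x.arg) := by
    have := ham.comp (measurable_norm (α := ℂ))
    have h2 : Measurable fun x : ℂ => ((x.arg : ℝ) : ℂ) :=
      Complex.measurable_ofReal.comp Complex.measurable_arg
    fun_prop
  refine h.aestronglyMeasurable.congr ((ae_restrict_mem measurableSet_ball).mono fun x hx => ?_)
  rw [mem_ball_zero_iff] at hx
  have : a ‖x‖ = radialAlpha V m.natAbs ‖x‖ := by
    rcases (norm_nonneg x).eq_or_lt with h0 | h0
    · rw [← h0, ha, piecewise_eq_of_notMem _ _ _ (by simp), radialAlpha, if_pos rfl]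
    · rw [ha, piecewise_eq_of_mem _ _ _ (mem_Ioc.2 ⟨h0, hx.le⟩)]
  simp only [this, diskMode]

theorem integrableOn_mul_potential
    (hV : IntegrableOn (fun r : ℝ => ((r * (1 - Real.log r) : ℝ) : ℂ) * V r) (Ioo 0 1) volume) :
    IntegrableOn (fun r : ℝ => (r : ℂ) * V r) (Ioo 0 1) volume := by
  refine Integrable.mono' (integrableOn_logWeight hV)
    (Complex.continuous_ofReal.aestronglyMeasurable.mul (aestronglyMeasurable_potential hV)) ?_
  refine (ae_restrict_mem measurableSet_Ioo).mono fun s hs => ?_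
  rw [norm_mul, Complex.norm_real, Real.norm_of_nonneg hs.1.le]
  exact mul_norm_le_logWeight V hs

/-- The planar Jacobian supplies the factor `r` that makes `V` integrable. -/
theorem integrableOn_potential_norm
    (hV : IntegrableOn (fun r : ℝ => ((r * (1 - Real.log r) : ℝ) : ℂ) * V r) (Ioo 0 1) volume) :
    IntegrableOn (fun x : ℂ => V ‖x‖) (Metric.ball 0 1) volume := by
  rw [integrableOn_fun_norm_addHaar]
  refine (integrableOn_mul_potential hV).congr_fun (fun r _ => ?_) measurableSet_Ioo
  simp [Complex.finrank_real_complex]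

theorem hasCompactSupport_laplacian (hc : HasCompactSupport φ) :
    HasCompactSupport (Laplacian.laplacian φ) := by
  refine HasCompactSupport.intro hc fun x hx => laplacian_eq_zero_of_notMem_tsupport hx

/-- The function `-Δφ + Vφ` is integrable on the disk. -/
theorem integrableOn_adjoint_testFunction
    (hV : IntegrableOn (fun r : ℝ => ((r * (1 - Real.log r) : ℝ) : ℂ) * V r) (Ioo 0 1) volume)
    (hφ : ContDiff ℝ ∞ φ) (hc : HasCompactSupport φ) :
    IntegrableOn (fun x => -(Laplacian.laplacian φ x) + V ‖x‖ * φ x) (Metric.ball 0 1)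
      volume := by
  obtain ⟨C, hC⟩ := hc.exists_bound_of_continuous hφ.continuous
  refine Integrable.add ?_ ?_
  · exact ((continuous_laplacian hφ).integrable_of_hasCompactSupport
      (hasCompactSupport_laplacian hc)).neg.integrableOn
  · exact Integrable.mul_bdd (c := C) (integrableOn_potential_norm hV)
      hφ.continuous.aestronglyMeasurable (Eventually.of_forall hC)

/-- Polar coordinates turn the Laplacian part and the potential part into the two sides of the
radial weak form, which cancel. -/
theorem integral_diskMode_mul_eq_zero
    (hV : IntegrableOn (fun r : ℝ => ((r * (1 - Real.log r) : ℝ) : ℂ) * V r) (Ioo 0 1) volume)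
    (hφ : ContDiff ℝ ∞ φ) (hc : HasCompactSupport φ)
    (hs : tsupport φ ⊆ Metric.ball (0 : ℂ) 1) (m : ℤ) :
    ∫ x in Metric.ball (0 : ℂ) 1,
      diskMode V m x * (-(Laplacian.laplacian φ x) + V ‖x‖ * φ x) = 0 := by
  have hb : ∀ᵐ x ∂volume.restrict (Metric.ball (0 : ℂ) 1),
      ‖diskMode V m x‖ ≤ Real.exp (logMass V 1) := by
    refine (ae_restrict_mem measurableSet_ball).mono fun x hx => ?_
    rw [mem_ball_zero_iff] at hx
    exact (norm_diskMode_le hV m hx.le).trans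
      (mul_le_of_le_one_left (Real.exp_pos _).le (pow_le_one₀ (norm_nonneg _) hx.le))
  have hnot : ∀ x : ℂ, 1 ≤ ‖x‖ → x ∉ tsupport φ := fun x hx h => by
    have := hs h
    rw [mem_ball_zero_iff] at this
    linarith
  have hm := aestronglyMeasurable_diskMode hV m
  have hi1 : IntegrableOn (fun x => diskMode V m x * Laplacian.laplacian φ x)
      (Metric.ball 0 1) volume :=
    Integrable.bdd_mul ((continuous_laplacian hφ).integrable_of_hasCompactSupport
      (hasCompactSupport_laplacian hc)).integrableOn hm hb
  obtain ⟨C, hC⟩ := hc.exists_bound_of_continuous hφ.continuous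
  have hi2 : IntegrableOn (fun x => diskMode V m x * (V ‖x‖ * φ x)) (Metric.ball 0 1) volume :=
    Integrable.bdd_mul (Integrable.mul_bdd (c := C) (integrableOn_potential_norm hV)
      hφ.continuous.aestronglyMeasurable (Eventually.of_forall hC)) hm hb
  have hαm : AEStronglyMeasurable (radialAlpha V m.natAbs) (volume.restrict (Ioo 0 1)) :=
    ((continuousOn_radialAlpha hV _).mono Ioo_subset_Ioc_self).aestronglyMeasurable
      measurableSet_Ioo
  have hαb : ∀ᵐ r : ℝ ∂volume.restrict (Ioo 0 1),
      ‖(r : ℂ) ^ m.natAbs * radialAlpha V m.natAbs r‖ ≤ Real.exp (logMass V 1) := by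
    refine (ae_restrict_mem measurableSet_Ioo).mono fun r hr => ?_
    rw [norm_mul, norm_pow, Complex.norm_real, Real.norm_of_nonneg hr.1.le]
    exact (mul_le_of_le_one_left (norm_nonneg _) (pow_le_one₀ hr.1.le hr.2.le)).trans
      (norm_radialAlpha_le hV _ (Ioo_subset_Icc_self hr))
  have hwm : AEStronglyMeasurable (fun r : ℝ => (r : ℂ) ^ m.natAbs * radialAlpha V m.natAbs r)
      (volume.restrict (Ioo 0 1)) :=
    (Complex.continuous_ofReal.pow _).aestronglyMeasurable.mul hαm
  have hrI : IntegrableOn (fun r : ℝ => (r : ℂ)) (Ioo 0 1) volume :=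
    (Complex.continuous_ofReal.continuousOn.integrableOn_compact isCompact_Icc).mono_set
      Ioo_subset_Icc_self
  have e1 := setIntegral_ball_radial_mul_mode (Integrable.mul_bdd hrI hwm hαb)
    (continuous_laplacian hφ) (hasCompactSupport_laplacian hc)
    (fun x hx => laplacian_eq_zero_of_notMem_tsupport (hnot x hx)) m
  have hR2 : IntegrableOn (fun r : ℝ => (r : ℂ) *
      (V r * ((r : ℂ) ^ m.natAbs * radialAlpha V m.natAbs r))) (Ioo 0 1) volume := by
    simp_rw [← mul_assoc _ (V _)]
    exact Integrable.mul_bdd (integrableOn_mul_potential hV) hwm hαb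
  have e2 := setIntegral_ball_radial_mul_mode hR2 hφ.continuous hc
    (fun x hx => image_eq_zero_of_notMem_tsupport (hnot x hx)) m
  have e3 := integral_radialAlpha_mul_angularCoeff hV hφ hs m
  have f1 : ∫ x in Metric.ball (0 : ℂ) 1, diskMode V m x * Laplacian.laplacian φ x
      = ∫ r in Ioo (0 : ℝ) 1, (r : ℂ) ^ (m.natAbs + 1) * radialAlpha V m.natAbs r
        * angularCoeff (Laplacian.laplacian φ) m r := by
    simp only [diskMode]
    rw [e1]
    congr 1
    ext r
    ring
  have f2 : ∫ x in Metric.ball (0 : ℂ) 1, diskMode V m x * (V ‖x‖ * φ x)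
      = ∫ r in Ioo (0 : ℝ) 1, (r : ℂ) ^ (m.natAbs + 1) * V r * radialAlpha V m.natAbs r
        * angularCoeff φ m r := by
    refine Eq.trans ?_ (e2.trans ?_)
    · congr 1
      ext x
      simp only [diskMode]
      ring
    · congr 1
      ext r
      ring
  simp_rw [mul_add, mul_neg]
  have h := integral_add hi1.neg hi2
  simp only [Pi.neg_apply] at h
  rw [h, integral_neg, f1, f2, e3, neg_add_cancel]

end Modes

/-! ### The series `u_f` -/

theorem summable_pow_natAbs_mul {ρ : ℝ} (h0 : 0 ≤ ρ) (h1 : ρ < 1) (N : ℕ) :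
    Summable fun m : ℤ => ρ ^ m.natAbs * (1 + |(m : ℝ)|) ^ N := by
  have h : Summable fun n : ℕ => ρ ^ ((n : ℤ)).natAbs * (1 + |((n : ℤ) : ℝ)|) ^ N := by
    have hρ : ‖ρ‖ < 1 := by rwa [Real.norm_of_nonneg h0]
    have hg : Summable fun n : ℕ => (n : ℝ) ^ N * ρ ^ n :=
      summable_pow_mul_geometric_of_norm_lt_one N hρ
    have hs : Summable fun n : ℕ => (2 : ℝ) ^ N * ((n : ℝ) ^ N * ρ ^ n) := hg.mul_left _
    refine Summable.of_norm_bounded_eventually_nat hs ?_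
    filter_upwards [eventually_ge_atTop 1] with n hn
    have hn' : (1 : ℝ) ≤ n := by exact_mod_cast hn
    rw [Int.natAbs_natCast, Int.cast_natCast, abs_of_nonneg (Nat.cast_nonneg n),
      Real.norm_of_nonneg (by positivity)]
    calc ρ ^ n * (1 + (n : ℝ)) ^ N ≤ ρ ^ n * (2 * n) ^ N := by
          gcongr
          linarith
      _ = _ := by rw [mul_pow]; ring
  refine Summable.of_nat_of_neg h ?_
  simpa using h

/-- The principal argument may differ from `θ` by a multiple of `2π`; an integer mode, being a power
of `e^(iθ)`, does not see it. -/
theorem exp_mode_arg_circleMap (m : ℤ) {r : ℝ} (hr : 0 < r) (θ : ℝ) :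
    Complex.exp (Complex.I * m * (circleMap 0 r θ).arg) = Complex.exp (Complex.I * m * θ) := by
  have key : ∀ t : ℝ, Complex.exp (Complex.I * m * t) = Complex.exp (t * Complex.I) ^ m := fun t => by
    rw [← Complex.exp_int_mul]
    congr 1
    ring
  rw [key, key]
  congr 1
  have h := Complex.norm_mul_exp_arg_mul_I (circleMap 0 r θ)
  have hr' : (r : ℂ) ≠ 0 := by exact_mod_cast hr.ne'
  rw [norm_circleMap_zero, abs_of_pos hr] at h
  refine mul_left_cancel₀ hr' (h.trans ?_)
  simp [circleMap]

section Series

variable {V : ℝ → ℂ}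

theorem poissonTerm_eq_diskMode (f : CircleDistribution) (x : ℂ) (m : ℤ) :
    poissonTerm V f ‖x‖ x.arg m
      = f.fourierCoeff m / radialAlpha V m.natAbs 1 * diskMode V m x := by
  rw [poissonTerm, diskMode]
  ring

/-- A polynomial bound on the quotients `α_{|m|}(r) f̂_m / α_{|m|}(1)`. -/
theorem exists_norm_poissonTerm_le
    (hV : IntegrableOn (fun r : ℝ => ((r * (1 - Real.log r) : ℝ) : ℂ) * V r) (Ioo 0 1) volume)
    (hα : ∀ m : ℕ, radialAlpha V m 1 ≠ 0) (f : CircleDistribution) :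
    ∃ (C : ℝ) (N : ℕ), 0 ≤ C ∧ ∀ r ∈ Icc (0 : ℝ) 1, ∀ (θ : ℝ) (m : ℤ),
      ‖poissonTerm V f r θ m‖ ≤ C * (r ^ m.natAbs * (1 + |(m : ℝ)|) ^ N) := by
  obtain ⟨c, hc0, hc⟩ := exists_pos_le_norm_radialAlpha_one hV hα
  obtain ⟨A, N, hA0, hA⟩ := f.exists_norm_fourierCoeff_le
  refine ⟨Real.exp (logMass V 1) / c * A, N, by positivity, fun r hr θ m => ?_⟩
  rw [poissonTerm, norm_mul, CircleTest.norm_exp_mode, mul_one, norm_mul, norm_div, norm_mul,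
    norm_pow, Complex.norm_real, Real.norm_of_nonneg hr.1]
  have hr0 := hr.1
  calc r ^ m.natAbs * ‖radialAlpha V m.natAbs r‖ / ‖radialAlpha V m.natAbs 1‖
        * ‖f.fourierCoeff m‖
      ≤ r ^ m.natAbs * Real.exp (logMass V 1) / c * (A * (1 + |(m : ℝ)|) ^ N) := by
        gcongr
        · exact norm_radialAlpha_le hV _ hr
        · exact hc _
        · exact hA m
    _ = _ := by ring

theorem summable_poissonTerm
    (hV : IntegrableOn (fun r : ℝ => ((r * (1 - Real.log r) : ℝ) : ℂ) * V r) (Ioo 0 1) volume)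
    (hα : ∀ m : ℕ, radialAlpha V m 1 ≠ 0) (f : CircleDistribution) {r : ℝ}
    (hr : r ∈ Ico (0 : ℝ) 1) (θ : ℝ) : Summable (poissonTerm V f r θ) := by
  obtain ⟨C, N, -, hC⟩ := exists_norm_poissonTerm_le hV hα f
  exact .of_norm_bounded ((summable_pow_natAbs_mul hr.1 hr.2 N).mul_left C)
    fun m => hC r (Ico_subset_Icc_self hr) θ m

theorem aestronglyMeasurable_poissonSeries
    (hV : IntegrableOn (fun r : ℝ => ((r * (1 - Real.log r) : ℝ) : ℂ) * V r) (Ioo 0 1) volume)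
    (hα : ∀ m : ℕ, radialAlpha V m 1 ≠ 0) (f : CircleDistribution) :
    AEStronglyMeasurable (poissonSeries V f) (volume.restrict (Metric.ball (0 : ℂ) 1)) := by
  refine aestronglyMeasurable_of_tendsto_ae (atTop : Filter (Finset ℤ))
    (f := fun s x => ∑ m ∈ s, poissonTerm V f ‖x‖ x.arg m) (fun s => ?_) ?_
  · simp_rw [poissonTerm_eq_diskMode]
    exact Finset.aestronglyMeasurable_fun_sum _
      fun m _ => (aestronglyMeasurable_diskMode hV m).const_mul _
  · refine (ae_restrict_mem measurableSet_ball).mono fun x hx => ?_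
    rw [mem_ball_zero_iff] at hx
    exact (summable_poissonTerm hV hα f ⟨norm_nonneg x, hx⟩ x.arg).hasSum

/-- On smaller disks the terms of the series are dominated by a summable sequence. -/
theorem exists_summable_bound_poissonTerm
    (hV : IntegrableOn (fun r : ℝ => ((r * (1 - Real.log r) : ℝ) : ℂ) * V r) (Ioo 0 1) volume)
    (hα : ∀ m : ℕ, radialAlpha V m 1 ≠ 0) (f : CircleDistribution) {ρ : ℝ} (h0 : 0 ≤ ρ)
    (h1 : ρ < 1) : ∃ b : ℤ → ℝ, Summable b ∧ ∀ r ∈ Icc 0 ρ, ∀ θ m,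
      ‖poissonTerm V f r θ m‖ ≤ b m := by
  obtain ⟨C, N, hC0, hC⟩ := exists_norm_poissonTerm_le hV hα f
  refine ⟨_, (summable_pow_natAbs_mul h0 h1 N).mul_left C, fun r hr θ m => ?_⟩
  refine (hC r ⟨hr.1, hr.2.trans h1.le⟩ θ m).trans ?_
  have := hr.1
  have := hr.2
  gcongr

theorem exists_norm_poissonSeries_le
    (hV : IntegrableOn (fun r : ℝ => ((r * (1 - Real.log r) : ℝ) : ℂ) * V r) (Ioo 0 1) volume)
    (hα : ∀ m : ℕ, radialAlpha V m 1 ≠ 0) (f : CircleDistribution) {ρ : ℝ} (h0 : 0 ≤ ρ)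
    (h1 : ρ < 1) : ∃ B, ∀ x : ℂ, ‖x‖ ≤ ρ → ‖poissonSeries V f x‖ ≤ B := by
  obtain ⟨b, hb, hle⟩ := exists_summable_bound_poissonTerm hV hα f h0 h1
  exact ⟨_, fun x hx => tsum_of_norm_bounded hb.hasSum fun m => hle ‖x‖ ⟨norm_nonneg x, hx⟩ x.arg m⟩

theorem exists_norm_le_of_isCompact_subset_ball {K : Set ℂ} (hK : IsCompact K)
    (h : K ⊆ Metric.ball (0 : ℂ) 1) : ∃ ρ, 0 ≤ ρ ∧ ρ < 1 ∧ ∀ x ∈ K, ‖x‖ ≤ ρ := by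
  rcases K.eq_empty_or_nonempty with rfl | hne
  · exact ⟨0, le_rfl, one_pos, by simp⟩
  · obtain ⟨y, hy, hmax⟩ := hK.exists_isMaxOn hne continuous_norm.continuousOn
    exact ⟨‖y‖, norm_nonneg y, mem_ball_zero_iff.1 (h hy), fun x hx => hmax hx⟩

theorem locallyIntegrableOn_poissonSeries
    (hV : IntegrableOn (fun r : ℝ => ((r * (1 - Real.log r) : ℝ) : ℂ) * V r) (Ioo 0 1) volume)
    (hα : ∀ m : ℕ, radialAlpha V m 1 ≠ 0) (f : CircleDistribution) :
    LocallyIntegrableOn (poissonSeries V f) (Metric.ball (0 : ℂ) 1) volume := by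
  rw [locallyIntegrableOn_iff Metric.isOpen_ball.isLocallyClosed]
  intro K hK hKc
  obtain ⟨ρ, h0, h1, hρ⟩ := exists_norm_le_of_isCompact_subset_ball hKc hK
  obtain ⟨B, hB⟩ := exists_norm_poissonSeries_le hV hα f h0 h1
  exact Integrable.mono' (integrableOn_const (C := B) hKc.measure_lt_top.ne)
    ((aestronglyMeasurable_poissonSeries hV hα f).mono_measure (Measure.restrict_mono_set _ hK))
    ((ae_restrict_mem hKc.measurableSet).mono fun x hx => hB x (hρ x hx))

/-- The support of `φ` lies in a disk of radius `ρ < 1`, where the terms have a summable majorant;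
as `-Δφ + Vφ` is integrable and vanishes off that support, the series may be integrated term by
term. -/
theorem isDistributionalSolution_poissonSeries
    (hV : IntegrableOn (fun r : ℝ => ((r * (1 - Real.log r) : ℝ) : ℂ) * V r) (Ioo 0 1) volume)
    (hα : ∀ m : ℕ, radialAlpha V m 1 ≠ 0) (f : CircleDistribution) :
    IsDistributionalSolution V (poissonSeries V f) := by
  refine ⟨locallyIntegrableOn_poissonSeries hV hα f, fun φ hφ hc hs => ?_⟩
  obtain ⟨ρ, h0, h1, hρ⟩ := exists_norm_le_of_isCompact_subset_ball hc hs
  set T : ℂ → ℂ := fun x => -(Laplacian.laplacian φ x) + V ‖x‖ * φ x with hT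
  have hTi : IntegrableOn T (Metric.ball 0 1) volume := integrableOn_adjoint_testFunction hV hφ hc
  have hT0 : ∀ x, x ∉ tsupport φ → T x = 0 := fun x hx => by
    simp only [hT]
    rw [laplacian_eq_zero_of_notMem_tsupport hx, image_eq_zero_of_notMem_tsupport hx]
    simp
  obtain ⟨b, hb, hle⟩ := exists_summable_bound_poissonTerm hV hα f h0 h1
  have hb0 : ∀ m, 0 ≤ b m := fun m => (norm_nonneg _).trans (hle 0 ⟨le_rfl, h0⟩ 0 m)
  have hterm : ∀ m (x : ℂ), ‖poissonTerm V f ‖x‖ x.arg m * T x‖ ≤ b m * ‖T x‖ := fun m x => by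
    by_cases hx : x ∈ tsupport φ
    · rw [norm_mul]
      exact mul_le_mul_of_nonneg_right (hle _ ⟨norm_nonneg x, hρ x hx⟩ _ m) (norm_nonneg _)
    · simp [hT0 x hx]
  have hm : ∀ m, AEStronglyMeasurable (fun x : ℂ => poissonTerm V f ‖x‖ x.arg m)
      (volume.restrict (Metric.ball (0 : ℂ) 1)) := fun m => by
    simp_rw [poissonTerm_eq_diskMode]
    exact (aestronglyMeasurable_diskMode hV m).const_mul _
  constructor
  · refine Integrable.mono' (hTi.norm.const_mul (∑' m, b m))
      ((aestronglyMeasurable_poissonSeries hV hα f).mul hTi.aestronglyMeasurable)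
      (Eventually.of_forall fun x => ?_)
    change ‖(∑' m, poissonTerm V f ‖x‖ x.arg m) * T x‖ ≤ _
    rw [← tsum_mul_right, ← tsum_mul_right]
    exact tsum_of_norm_bounded (hb.mul_right _).hasSum fun m => hterm m x
  · have hsum := hasSum_integral_of_dominated_convergence
      (μ := volume.restrict (Metric.ball (0 : ℂ) 1))
      (F := fun m x => poissonTerm V f ‖x‖ x.arg m * T x) (f := fun x => poissonSeries V f x * T x)
      (bound := fun m x => b m * ‖T x‖) (fun m => (hm m).mul hTi.aestronglyMeasurable)
      (fun m => Eventually.of_forall fun x => hterm m x)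
      (Eventually.of_forall fun x => hb.mul_right _)
      (by simp_rw [tsum_mul_right]; exact hTi.norm.const_mul _)
      ((ae_restrict_mem measurableSet_ball).mono fun x hx => by
        rw [mem_ball_zero_iff] at hx
        exact (summable_poissonTerm hV hα f ⟨norm_nonneg x, hx⟩ x.arg).hasSum.mul_right _)
    have hzero : ∀ m : ℤ, ∫ x in Metric.ball (0 : ℂ) 1, poissonTerm V f ‖x‖ x.arg m * T x = 0 := by
      intro m
      simp_rw [poissonTerm_eq_diskMode, mul_assoc]
      rw [integral_const_mul, hT, integral_diskMode_mul_eq_zero hV hφ hc hs m, mul_zero]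
    simp_rw [hzero] at hsum
    exact hsum.unique hasSum_zero

/-! ### Traces on circles and the boundary value. -/

theorem poissonSeries_circleMap (f : CircleDistribution) {r : ℝ} (hr : 0 < r) (θ : ℝ) :
    poissonSeries V f (circleMap 0 r θ) = ∑' m, poissonTerm V f r θ m := by
  rw [poissonSeries]
  refine tsum_congr fun m => ?_
  rw [poissonTerm, poissonTerm, exp_mode_arg_circleMap m hr, norm_circleMap_zero, abs_of_pos hr]

theorem continuous_poissonTerm (f : CircleDistribution) (r : ℝ) (m : ℤ) :
    Continuous fun θ => poissonTerm V f r θ m := by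
  unfold poissonTerm
  fun_prop

theorem hasSum_integral_poissonSeries_mul
    (hV : IntegrableOn (fun r : ℝ => ((r * (1 - Real.log r) : ℝ) : ℂ) * V r) (Ioo 0 1) volume)
    (hα : ∀ m : ℕ, radialAlpha V m 1 ≠ 0) (f : CircleDistribution) {r : ℝ}
    (hr : r ∈ Ioo (0 : ℝ) 1) (φ : CircleTest) :
    HasSum (fun m : ℤ => (r : ℂ) ^ m.natAbs * radialAlpha V m.natAbs r / radialAlpha V m.natAbs 1
        * (2 * Real.pi * f.fourierCoeff m * φ.coeff (-m)))
      (∫ θ in (0 : ℝ)..(2 * Real.pi), poissonSeries V f (circleMap 0 r θ) * φ θ) := by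
  obtain ⟨b, hb, hle⟩ := exists_summable_bound_poissonTerm hV hα f hr.1.le hr.2
  have h := intervalIntegral.hasSum_integral_of_dominated_convergence (μ := volume)
    (a := 0) (b := 2 * Real.pi) (F := fun m θ => poissonTerm V f r θ m * φ θ)
    (f := fun θ => poissonSeries V f (circleMap 0 r θ) * φ θ) (bound := fun m θ => b m * ‖φ θ‖)
    (fun m => ((continuous_poissonTerm f r m).mul φ.continuous).aestronglyMeasurable)
    (fun m => Eventually.of_forall fun θ _ => by
      rw [norm_mul]
      exact mul_le_mul_of_nonneg_right (hle r ⟨hr.1.le, le_rfl⟩ θ m) (norm_nonneg _))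
    (Eventually.of_forall fun θ _ => hb.mul_right _)
    (by
      simp_rw [tsum_mul_right]
      exact (φ.continuous.norm.const_mul _).intervalIntegrable _ _)
    (Eventually.of_forall fun θ _ => by
      rw [poissonSeries_circleMap f hr.1]
      exact (summable_poissonTerm hV hα f ⟨hr.1.le, hr.2⟩ θ).hasSum.mul_right _)
  refine h.congr_fun fun m => ?_
  have hpi : (Real.pi : ℂ) ≠ 0 := by exact_mod_cast Real.pi_ne_zero
  simp only [poissonTerm, mul_assoc]
  rw [CircleTest.coeff, neg_neg]
  simp only [mul_assoc, mul_div_assoc, intervalIntegral.integral_const_mul]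
  field_simp

theorem intervalIntegrable_poissonSeries
    (hV : IntegrableOn (fun r : ℝ => ((r * (1 - Real.log r) : ℝ) : ℂ) * V r) (Ioo 0 1) volume)
    (hα : ∀ m : ℕ, radialAlpha V m 1 ≠ 0) (f : CircleDistribution) {r : ℝ}
    (hr : r ∈ Ioo (0 : ℝ) 1) :
    IntervalIntegrable (fun θ => poissonSeries V f (circleMap 0 r θ)) volume 0 (2 * Real.pi) := by
  obtain ⟨b, hb, hle⟩ := exists_summable_bound_poissonTerm hV hα f hr.1.le hr.2
  simp_rw [poissonSeries_circleMap f hr.1]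
  exact (continuous_tsum (fun m => continuous_poissonTerm f r m) hb
    fun m θ => hle r ⟨hr.1.le, le_rfl⟩ θ m).intervalIntegrable _ _

theorem tendsto_integral_poissonSeries
    (hV : IntegrableOn (fun r : ℝ => ((r * (1 - Real.log r) : ℝ) : ℂ) * V r) (Ioo 0 1) volume)
    (hα : ∀ m : ℕ, radialAlpha V m 1 ≠ 0) (f : CircleDistribution) (φ : CircleTest) :
    Tendsto (fun r : ℝ => ∫ θ in (0 : ℝ)..(2 * Real.pi), poissonSeries V f (circleMap 0 r θ) * φ θ)
      (𝓝[<] (1 : ℝ)) (𝓝 (f φ)) := by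
  obtain ⟨c, hc0, hc⟩ := exists_pos_le_norm_radialAlpha_one hV hα
  obtain ⟨A, N, hA0, hA⟩ := f.exists_norm_fourierCoeff_le
  have hmem : ∀ᶠ r : ℝ in 𝓝[<] (1 : ℝ), r ∈ Ioo (0 : ℝ) 1 := Ioo_mem_nhdsLT one_pos
  have hcoeff : Summable fun m : ℤ => ‖2 * Real.pi * f.fourierCoeff m * φ.coeff (-m)‖ := by
    have h := ((Equiv.neg ℤ).summable_iff.2 (φ.summable_pow_mul_norm_coeff N)).mul_left
      (‖(2 * Real.pi : ℂ)‖ * A)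
    refine Summable.of_nonneg_of_le (fun m => norm_nonneg _) (fun m => ?_) h
    rw [norm_mul, norm_mul]
    simp only [Function.comp_apply, Equiv.neg_apply, Int.cast_neg, abs_neg]
    calc _ ≤ ‖(2 * Real.pi : ℂ)‖ * (A * (1 + |(m : ℝ)|) ^ N) * ‖φ.coeff (-m)‖ := by
          gcongr
          exact hA m
      _ = _ := by ring
  have hlim : Tendsto (fun r : ℝ => ∑' m : ℤ, (r : ℂ) ^ m.natAbs * radialAlpha V m.natAbs r
      / radialAlpha V m.natAbs 1 * (2 * Real.pi * f.fourierCoeff m * φ.coeff (-m)))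
      (𝓝[<] (1 : ℝ)) (𝓝 (∑' m : ℤ, 2 * Real.pi * f.fourierCoeff m * φ.coeff (-m))) := by
    -- The quotients are bounded by `exp W / c` independently of `r` and `m`; summability comes
    -- entirely from the decay of the coefficients of `φ` against the growth of those of `f`.
    refine tendsto_tsum_of_dominated_convergence
      (hcoeff.mul_left (Real.exp (logMass V 1) / c)) (fun m => ?_) ?_
    · have h1 : Tendsto (radialAlpha V m.natAbs) (𝓝[<] (1 : ℝ)) (𝓝 (radialAlpha V m.natAbs 1)) := by
        have := continuousOn_radialAlpha hV m.natAbs 1 ⟨one_pos, le_rfl⟩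
        refine this.tendsto.mono_left ?_
        rw [← nhdsWithin_Ioo_eq_nhdsLT (one_pos : (0 : ℝ) < 1)]
        exact nhdsWithin_mono _ Ioo_subset_Ioc_self
      have h2 : Tendsto (fun r : ℝ => (r : ℂ) ^ m.natAbs) (𝓝[<] (1 : ℝ)) (𝓝 1) := by
        have : Continuous fun r : ℝ => (r : ℂ) ^ m.natAbs := Complex.continuous_ofReal.pow _
        simpa using (this.tendsto 1).mono_left nhdsWithin_le_nhds
      have h3 := ((h2.mul h1).div_const (radialAlpha V m.natAbs 1)).mul_const
        (2 * Real.pi * f.fourierCoeff m * φ.coeff (-m))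
      rwa [one_mul, div_self (hα _), one_mul] at h3
    · filter_upwards [hmem] with r hr m
      rw [norm_mul, norm_div, norm_mul, norm_pow, Complex.norm_real, Real.norm_of_nonneg hr.1.le]
      refine mul_le_mul_of_nonneg_right ?_ (norm_nonneg _)
      refine div_le_div₀ (Real.exp_pos _).le ?_ hc0 (hc _)
      exact (mul_le_of_le_one_left (norm_nonneg _) (pow_le_one₀ hr.1.le hr.2.le)).trans
        (norm_radialAlpha_le hV _ (Ioo_subset_Icc_self hr))
  rw [(f.hasSum_coeff_mul φ).tsum_eq] at hlim
  refine hlim.congr' ?_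
  filter_upwards [hmem] with r hr
  exact (hasSum_integral_poissonSeries_mul hV hα f hr φ).tsum_eq

end Series

end

theorem mainTheorem9 (V : ℝ → ℂ)
    (hV : IntegrableOn (fun r : ℝ => ((r * (1 - Real.log r) : ℝ) : ℂ) * V r) (Set.Ioo 0 1) volume)
    (hα : ∀ m : ℕ, radialAlpha V m 1 ≠ 0)
    (f : CircleDistribution) :
    (∀ r ∈ Set.Ico (0 : ℝ) 1, ∀ θ : ℝ, Summable (poissonTerm V f r θ)) ∧
      IsDistributionalSolution V (poissonSeries V f) ∧
      HasDistributionalBoundaryValue (poissonSeries V f) f := by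
  refine ⟨fun r hr θ => summable_poissonTerm hV hα f hr θ,
    isDistributionalSolution_poissonSeries hV hα f,
    locallyIntegrableOn_poissonSeries hV hα f, ?_, tendsto_integral_poissonSeries hV hα f⟩
  filter_upwards [Ioo_mem_nhdsLT one_pos] with r hr
  exact intervalIntegrable_poissonSeries hV hα f hr
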